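/- Let $\tau\in\mathbb R$, $H\in(-\tfrac12,\tfrac12)$ and $h\in[-\tfrac12,\tfrac12]$. Let $\mathbb H^2$ be the Poincaré disk $\{x^2+y^2<1\}$ with metric $\lambda^2(dx^2+dy^2)$, $\lambda=\frac{2}{1-x^2-y^2}$, and let $\mathbb E(-1,\tau)$ be represented as $\mathbb H^2\times\mathbb R$ with the metric $\lambda^2(dx^2+dy^2)+[\lambda(a\,dx+b\,dy)+dt]^2$, where $$a=2y\tau+2hx\sqrt{\tfrac{1+4(x^2+y^2)\tau^2}{1-4h^2(x^2+y^2)}},\qquad b=-2x\tau+2hy\sqrt{\tfrac{1+4(x^2+y^2)\tau^2}{1-4h^2(x^2+y^2)}}$$ ($h=0$ is the classical cylinder model; $h=H$ is the model in which $\{t=0\}$ is a rotational surface of constant mean curvature $H$). For a $C^2$ function $u$ on an open set of $\mathbb H^2$ put $$H(u)=\tfrac12\operatorname{div}\Big(\tfrac{Gu}{\sqrt{1+\|Gu\|^2}}\Big),\qquad Gu=\tfrac1{\lambda^2}\big[(u_x+\lambda a)\partial_x+(u_y+\lambda b)\partial_y\big],$$ with divergence and norm taken in $\mathbb H^2$;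 this is the mean curvature of the vertical graph of $u$. An ideal $H$-polygon consists of $n\ge 2$ distinct vertices $p_1,\dots,p_n\in\partial_\infty\mathbb H^2$ and, for each $i$ (modulo $n$), a complete curve $\Gamma_i\subset\mathbb H^2$ of constant geodesic curvature $2H$ or $-2H$ with ideal endpoints $p_i$ and $p_{i+1}$, the curves $\Gamma_1,\dots,\Gamma_n$ being pairwise disjoint. Closures and boundaries below are taken in $\mathbb H^2$ (ideal points are not included). **Theorem (general maximum principle).** Let $\Omega_0\subset\mathbb H^2$ be a domain whose boundary $\partial\Omega_0=\Gamma_1\cup\dots\cup\Gamma_n$ is an ideal $H$-polygon. Suppose that at every vertex $p_{i+1}$ the two adjacent sides come arbitrarily close, that is, $$\liminf_{\Gamma_i\ni q\to p_{i+1},\ \Gamma_{i+1}\ni q'\to p_{i+1}}\operatorname{dist}_{\mathbb H^2}(q,q')=0 .$$ Let $W\subset\Omega_0$ be a domain and let $u_1,u_2\in C^2(W)\cap C^0(\overline W)$ satisfy $H(u_1)=H(u_2)=H$ in $W$ and $u_1<u_2$ on $\partial W$. Then $u_1\le u_2$ in $W$. -/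

import Mathlib

open Filter Topology Metric ComplexConjugate

noncomputable section

namespace KillingGraph

/-! The hyperbolic plane is the Poincare disk: the open unit disk of `ℂ` with the conformal metric
`cf² (dx² + dy²)`, `cf = 2 / (1 - |z|²)`, of curvature `-1`. Its ideal boundary is the unit
circle. -/

/-- The open unit disk, underlying set of the Poincare disk. -/
def disk : Set ℂ := ball 0 1

/-- The conformal factor of the Poincare disk. -/
def cf (z : ℂ) : ℝ := 2 / (1 - ‖z‖ ^ 2)

/-- The hyperbolic distance between two points of the Poincare disk. -/
def hdist (z w : ℂ) : ℝ :=
  2 * Real.arsinh (‖z - w‖ / Real.sqrt ((1 - ‖z‖ ^ 2) * (1 - ‖w‖ ^ 2)))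

/-- The partial derivative of `f` in the direction of `x`. -/
def dx (f : ℂ → ℝ) (z : ℂ) : ℝ := fderiv ℝ f z 1

/-- The partial derivative of `f` in the direction of `y`. -/
def dy (f : ℂ → ℝ) (z : ℂ) : ℝ := fderiv ℝ f z Complex.I

/-- The Riemannian divergence, in the Poincare disk, of the field `X₁ ∂x + X₂ ∂y`. -/
def hdiv (X₁ X₂ : ℂ → ℝ) (z : ℂ) : ℝ :=
  (dx (fun w => cf w ^ 2 * X₁ w) z + dy (fun w => cf w ^ 2 * X₂ w) z) / cf z ^ 2

/-! The model `𝒞_h` of `𝔼(-1, τ)` is the product `disk × ℝ` with the metric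
`cf² (dx² + dy²) + (cf (a dx + b dy) + dt)²`, where `a`, `b` are the two functions below.
For `h = 0` it is the classical cylinder model; in general the slice `t = 0` is the entire
rotational graph of constant mean curvature `h`. -/

/-- The coefficient of `dx` in the connection form of the model `𝒞_h` of `𝔼(-1, τ)`. -/
def coeffA (τ h : ℝ) (z : ℂ) : ℝ :=
  2 * z.im * τ +
    2 * h * z.re * Real.sqrt ((1 + 4 * ‖z‖ ^ 2 * τ ^ 2) / (1 - 4 * h ^ 2 * ‖z‖ ^ 2))

/-- The coefficient of `dy` in the connection form of the model `𝒞_h` of `𝔼(-1, τ)`. -/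
def coeffB (τ h : ℝ) (z : ℂ) : ℝ :=
  -2 * z.re * τ +
    2 * h * z.im * Real.sqrt ((1 + 4 * ‖z‖ ^ 2 * τ ^ 2) / (1 - 4 * h ^ 2 * ‖z‖ ^ 2))

/-- The `∂x` component of the generalized gradient `Gu` of `u`. -/
def gradX (τ h : ℝ) (u : ℂ → ℝ) (z : ℂ) : ℝ := (dx u z + cf z * coeffA τ h z) / cf z ^ 2

/-- The `∂y` component of the generalized gradient `Gu` of `u`. -/
def gradY (τ h : ℝ) (u : ℂ → ℝ) (z : ℂ) : ℝ := (dy u z + cf z * coeffB τ h z) / cf z ^ 2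

/-- The area element `√(1 + ‖Gu‖²)`, where the norm is the hyperbolic one. -/
def areaElt (τ h : ℝ) (u : ℂ → ℝ) (z : ℂ) : ℝ :=
  Real.sqrt (1 + cf z ^ 2 * (gradX τ h u z ^ 2 + gradY τ h u z ^ 2))

/-- The mean curvature `H(u) = ½ div (Gu / √(1 + ‖Gu‖²))`, at the point over `z`, of the vertical
graph of `u` in the model `𝒞_h` of `𝔼(-1, τ)`. -/
def meanCurvature (τ h : ℝ) (u : ℂ → ℝ) (z : ℂ) : ℝ :=
  hdiv (fun w => gradX τ h u w / areaElt τ h u w) (fun w => gradY τ h u w / areaElt τ h u w) z / 2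

/-- The graph of `u` over the open set `W` is an `H`-graph in the model `𝒞_h` of `𝔼(-1, τ)`. -/
def IsHGraph (τ h H : ℝ) (W : Set ℂ) (u : ℂ → ℝ) : Prop :=
  ContDiffOn ℝ 2 u W ∧ ∀ z ∈ W, meanCurvature τ h u z = H

/-- `γ` is a complete curve in the hyperbolic plane, parametrized by hyperbolic arc length, of
constant geodesic curvature `k` with respect to the unit normal `i γ'`. The left-hand side of
`curvature_eq` is the covariant acceleration of `γ`. -/
structure IsConstCurvatureCurve (k : ℝ) (γ : ℝ → ℂ) : Prop where
  contDiff : ContDiff ℝ 2 γ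
  mem_disk : ∀ s, γ s ∈ disk
  unit_speed : ∀ s, cf (γ s) * ‖deriv γ s‖ = 1
  curvature_eq : ∀ s,
    deriv (deriv γ) s + 2 * conj (γ s) / ((1 - ‖γ s‖ ^ 2 : ℝ) : ℂ) * deriv γ s ^ 2
      = (k : ℂ) * Complex.I * deriv γ s

/-- `Γ` is a complete curve of constant geodesic curvature `±2H` with ideal endpoints `p`, `q`. -/
def IsHEdge (H : ℝ) (p q : ℂ) (Γ : Set ℂ) : Prop :=
  ∃ (k : ℝ) (γ : ℝ → ℂ), (k = 2 * H ∨ k = -(2 * H)) ∧ IsConstCurvatureCurve k γ ∧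
    Tendsto γ atBot (𝓝 p) ∧ Tendsto γ atTop (𝓝 q) ∧ Set.range γ = Γ

/-- An ideal `H`-polygon: finitely many distinct vertices `p i` on the ideal boundary and, for
every `i` (modulo `n`), an edge `Γ i` of geodesic curvature `±2H` from `p i` to `p (i + 1)`, the
edges being pairwise disjoint. -/
structure IsIdealHPolygon (H : ℝ) {n : ℕ} [NeZero n] (p : Fin n → ℂ) (Γ : Fin n → Set ℂ) :
    Prop where
  two_le : 2 ≤ n
  vertex_ideal : ∀ i, ‖p i‖ = 1
  vertex_injective : Function.Injective p
  edge : ∀ i, IsHEdge H (p i) (p (i + 1)) (Γ i)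
  edge_disjoint : Pairwise fun i j => Disjoint (Γ i) (Γ j)

/-- The lower limit of the hyperbolic distance between points of `Γ₁` and of `Γ₂` converging to
the ideal point `p` is zero. -/
def ArbitrarilyCloseAt (p : ℂ) (Γ₁ Γ₂ : Set ℂ) : Prop :=
  ∀ ε > 0, ∃ᶠ q in 𝓝[Γ₁] p ×ˢ 𝓝[Γ₂] p, hdist q.1 q.2 < ε

/-- A domain of the hyperbolic plane. -/
def IsDomainOfDisk (U : Set ℂ) : Prop := IsOpen U ∧ IsConnected U ∧ U ⊆ disk

/-- The boundary in the hyperbolic plane (ideal points are not included). -/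
def hbdry (U : Set ℂ) : Set ℂ := frontier U ∩ disk

/-- The closure in the hyperbolic plane (ideal points are not included). -/
def hclosure (U : Set ℂ) : Set ℂ := closure U ∩ disk

end KillingGraph

end

/-!
The proof tests the difference of the two mean curvature equations against a truncation of
`d = u₁ - u₂`. Write `V u = Gu / √(1 + ‖Gu‖²)`, a field of norm less than `1`. Then `V u₁ - V u₂` is
divergence free in `W`, and `⟨V u₁ - V u₂, ∇d⟩ ≥ 0` with equality only where `∇d = 0`
(`flux_pairing`). Let `σ` be the smooth step function. As `d < 0` on `∂W`, the function `σ(d)` is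
supported away from `∂W`, so that `η σ(d)` is an admissible test function for any function `η` of
compact support in the disk, and
`∫ η σ'(d) ⟨V u₁ - V u₂, ∇d⟩ = - ∫ σ(d) ⟨V u₁ - V u₂, ∇η⟩`.
For the cutoff functions `η = σ(R (1 - |z|²) - 1)` the right-hand side is `O(1 / R)`, because the
domain is thin near the ideal boundary: its part where `1 - |z|² ≤ 2 / R` has Euclidean area
`O(1 / R³)` (`volume_ends_le`). Hence `σ'(d) ∇d = 0` (`deriv_mul_pairing_eq_zero`), and `σ(d)` is
constant on `W`. If `d` is positive somewhere, it is positive on all of `W`; then `W` has no boundary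
point in the disk, so it is the whole disk, which is impossible since `∂Ω₀` is not empty.

The thinness of the ends is where the geometry of the polygon enters. A curve of constant curvature
`k`, `|k| < 1`, is a circular arc, cut out in the disk by an equation `edgeFun k n c = 0`
(`exists_edgeFun_eq_zero`, `IsHEdge.eq_setOf`). The equation of each edge can be taken positive on
`Ω₀`. In the half plane model with a vertex at infinity the two adjacent edges are rays; coming
arbitrarily close they are parallel, and near the vertex `Ω₀` lies in the strip between them
(`opposite_at_vertex`). In the disk this strip is a cusp of width `O(|z - p|²)` at the vertex `p`.
An order argument on the circle shows that `Ω₀` accumulates at no other ideal point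
(`exists_edgeFun_neg`).
-/

noncomputable section

namespace KillingGraph

/-! ### Curves of constant geodesic curvature -/

lemma norm_sq_eq (z : ℂ) : ‖z‖ ^ 2 = z.re ^ 2 + z.im ^ 2 := by
  rw [Complex.sq_norm, Complex.normSq_apply]; ring

/-- A real-valued function on the plane, quadratic in `z`, whose zero set is a circle or a line. In the
hyperboloid model, where `z` is represented by `X = (1 + |z|², 2 z) / (1 - |z|²)`, it is
`(1 - |z|²) (⟨(c, n), X⟩ + k)` for the Lorentz product `⟨·, ·⟩`; for a vector `(c, n)` of square
norm `1 - k²`, its zero set in the disk is an equidistant curve of geodesic curvature `±k`. -/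
def edgeFun (k : ℝ) (n : ℂ) (c : ℝ) (z : ℂ) : ℝ :=
  2 * (n.re * z.re + n.im * z.im) - c * (1 + ‖z‖ ^ 2) + k * (1 - ‖z‖ ^ 2)

lemma mem_disk_iff {z : ℂ} : z ∈ disk ↔ ‖z‖ < 1 := by simp [disk]

lemma one_sub_norm_sq_pos {z : ℂ} (hz : z ∈ disk) : 0 < 1 - ‖z‖ ^ 2 := by
  have := mem_disk_iff.1 hz
  nlinarith [norm_nonneg z]

lemma ofReal_one_sub_norm_sq (z : ℂ) : ((1 - ‖z‖ ^ 2 : ℝ) : ℂ) = 1 - z * conj z := by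
  rw [Complex.mul_conj, Complex.normSq_eq_norm_sq]; push_cast; ring

/-- A curve of constant geodesic curvature lies on a circle or a line: if `X` is the curve in the
hyperboloid and `ν` its unit normal, then `X'' = X + k ν` and `ν' = -k X'`, so that the vector
`ν + k X` is constant; its product with `X` is `-k`. -/
theorem exists_edgeFun_eq_zero {k : ℝ} {γ : ℝ → ℂ} (hγ : IsConstCurvatureCurve k γ) :
    ∃ (n : ℂ) (c : ℝ), n.re ^ 2 + n.im ^ 2 - c ^ 2 = 1 - k ^ 2 ∧
      ∀ s, edgeFun k n c (γ s) = 0 := by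
  have hD : ∀ s, (1 - γ s * conj (γ s) : ℂ) ≠ 0 := fun s => by
    rw [← ofReal_one_sub_norm_sq]
    exact_mod_cast (one_sub_norm_sq_pos (hγ.mem_disk s)).ne'
  have hz : ∀ s, HasDerivAt γ (deriv γ s) s := fun s =>
    (hγ.contDiff.differentiable (by norm_num) s).hasDerivAt
  have hv : ∀ s, HasDerivAt (deriv γ) (deriv (deriv γ) s) s := fun s =>
    ((hγ.contDiff.iterate_deriv' 1 1).differentiable (by norm_num) s).hasDerivAt
  have conj_d : ∀ {f : ℝ → ℂ} {f' : ℂ} {s : ℝ}, HasDerivAt f f' s →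
      HasDerivAt (fun t => conj (f t)) (conj f') s := fun h => by
    exact Complex.conjCLE.toContinuousLinearMap.hasFDerivAt.comp_hasDerivAt _ h
  have ha : ∀ s, deriv (deriv γ) s = k * Complex.I * deriv γ s
      - 2 * conj (γ s) / (1 - γ s * conj (γ s)) * deriv γ s ^ 2 := fun s => by
    rw [← ofReal_one_sub_norm_sq, ← hγ.curvature_eq s]; ring
  -- `γ` and its conjugate are treated as independent variables in the identities below.
  have hab : ∀ s, conj (deriv (deriv γ) s) = -(k * Complex.I * conj (deriv γ s))
      - 2 * γ s / (1 - γ s * conj (γ s)) * conj (deriv γ s) ^ 2 := fun s => by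
    rw [ha s]; simp only [map_sub, map_mul, map_div₀, map_pow, Complex.conj_ofReal, Complex.conj_I,
      Complex.conj_conj, map_one, map_ofNat]; ring
  -- `(C, N)` is the vector `ν + k X` of the hyperboloid model.
  set N : ℝ → ℂ := fun s =>
    2 * Complex.I * (deriv γ s - γ s ^ 2 * conj (deriv γ s)) / (1 - γ s * conj (γ s)) ^ 2
      + 2 * k * γ s / (1 - γ s * conj (γ s)) with hN
  set C : ℝ → ℂ := fun s =>
    2 * Complex.I * (conj (γ s) * deriv γ s - γ s * conj (deriv γ s))
      / (1 - γ s * conj (γ s)) ^ 2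
      + k * (1 + γ s * conj (γ s)) / (1 - γ s * conj (γ s)) with hC
  have hDd : ∀ s, HasDerivAt (fun s => 1 - γ s * conj (γ s))
      (-(deriv γ s * conj (γ s) + γ s * conj (deriv γ s))) s := fun s =>
    ((hz s).mul (conj_d (hz s))).const_sub 1
  have hNd : ∀ s, HasDerivAt N 0 s := fun s => by
    have h1 := ((((hv s).sub (((hz s).pow 2).mul (conj_d (hv s)))).const_mul
      (2 * Complex.I)).div ((hDd s).pow 2) (pow_ne_zero 2 (hD s))).add
      (((hz s).const_mul (2 * (k : ℂ))).div (hDd s) (hD s))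
    refine h1.congr_deriv ?_
    have := hD s
    simp only [Pi.pow_apply, Pi.mul_apply, Pi.sub_apply]
    rw [hab s, ha s]
    obtain ⟨D, hDs⟩ : ∃ D, D = 1 - γ s * conj (γ s) := ⟨_, rfl⟩
    simp only [← hDs] at this ⊢
    field_simp
    rw [hDs]
    push_cast
    ring_nf
    simp only [Complex.I_sq]
    ring
  have hCd : ∀ s, HasDerivAt C 0 s := fun s => by
    have h1 := (((((conj_d (hz s)).mul (hv s)).sub ((hz s).mul (conj_d (hv s)))).const_mul
      (2 * Complex.I)).div ((hDd s).pow 2) (pow_ne_zero 2 (hD s))).add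
      (((((hz s).mul (conj_d (hz s))).const_add 1).const_mul (k : ℂ)).div (hDd s) (hD s))
    refine h1.congr_deriv ?_
    have := hD s
    simp only [Pi.pow_apply, Pi.mul_apply, Pi.sub_apply]
    rw [hab s, ha s]
    obtain ⟨D, hDs⟩ : ∃ D, D = 1 - γ s * conj (γ s) := ⟨_, rfl⟩
    simp only [← hDs] at this ⊢
    field_simp
    rw [hDs]
    push_cast
    ring_nf
    simp only [Complex.I_sq]
    ring
  have hNc : ∀ s, N s = N 0 := fun s =>
    is_const_of_deriv_eq_zero (fun t => (hNd t).differentiableAt) (fun t => (hNd t).deriv) s 0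
  have hCc : ∀ s, C s = C 0 := fun s =>
    is_const_of_deriv_eq_zero (fun t => (hCd t).differentiableAt) (fun t => (hCd t).deriv) s 0
  have hNb : ∀ s, conj (N s) = -(2 * Complex.I * (conj (deriv γ s)
      - conj (γ s) ^ 2 * deriv γ s) / (1 - γ s * conj (γ s)) ^ 2)
      + 2 * k * conj (γ s) / (1 - γ s * conj (γ s)) := fun s => by
    simp only [hN, map_add, map_sub, map_mul, map_div₀, map_pow, Complex.conj_ofReal, Complex.conj_I,
      Complex.conj_conj, map_one, map_ofNat]; ring
  have hCb : conj (C 0) = C 0 := by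
    simp only [hC, map_add, map_sub, map_mul, map_div₀, map_pow, Complex.conj_ofReal, Complex.conj_I,
      Complex.conj_conj, map_one, map_ofNat]; ring
  have hCre : ((C 0).re : ℂ) = C 0 := Complex.conj_eq_iff_re.1 hCb
  refine ⟨N 0, (C 0).re, ?_, fun s => ?_⟩
  · have hsp : 4 * (deriv γ 0 * conj (deriv γ 0)) = (1 - γ 0 * conj (γ 0)) ^ 2 := by
      have h0 := hγ.unit_speed 0
      have hp := one_sub_norm_sq_pos (hγ.mem_disk 0)
      have h1 : 2 * ‖deriv γ 0‖ = 1 - ‖γ 0‖ ^ 2 := by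
        unfold cf at h0; field_simp at h0; linarith
      rw [← ofReal_one_sub_norm_sq, ← h1, Complex.mul_conj, Complex.normSq_eq_norm_sq]
      push_cast; ring
    have key : N 0 * conj (N 0) - C 0 ^ 2 = 1 - (k : ℂ) ^ 2 := by
      have := hD 0
      rw [hNb 0]
      simp only [hN, hC]
      field_simp
      ring_nf
      simp only [Complex.I_sq]
      linear_combination (-1 + γ 0 * conj (γ 0)) ^ 2 * hsp
    rw [← hCre, Complex.mul_conj] at key
    have : Complex.normSq (N 0) - (C 0).re ^ 2 = 1 - k ^ 2 := by exact_mod_cast key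
    rw [Complex.normSq_apply] at this
    linarith
  · have key : N 0 * conj (γ s) + conj (N 0) * γ s - C 0 * (1 + γ s * conj (γ s))
        + k * (1 - γ s * conj (γ s)) = 0 := by
      have := hD s
      rw [← hNc s, ← hCc s, hNb s]
      simp only [hN, hC]
      field_simp
      ring
    rw [← hCre, Complex.mul_conj] at key
    have := congrArg Complex.re key
    simp only [Complex.normSq_apply, Complex.add_re, Complex.sub_re, Complex.mul_re,
      Complex.conj_re, Complex.conj_im, Complex.ofReal_re, Complex.ofReal_im, Complex.one_re,
      Complex.zero_re, Complex.add_im, Complex.sub_im, Complex.one_im] at this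
    rw [edgeFun, norm_sq_eq]
    linarith

/-! ### The half plane model and the equation of an edge -/

@[fun_prop]
lemma continuous_edgeFun (k : ℝ) (n : ℂ) (c : ℝ) : Continuous (edgeFun k n c) := by
  unfold edgeFun; fun_prop

/-- The Cayley transform of the disk onto the right half plane, sending the ideal point `p` to
infinity. The real part is the height of the half plane model. -/
def halfPlane (p z : ℂ) : ℂ := (p + z) / (p - z)

lemma halfPlane_re {p z : ℂ} (hp : ‖p‖ = 1) :
    (halfPlane p z).re = (1 - ‖z‖ ^ 2) / ‖p - z‖ ^ 2 := by
  have h1 := norm_sq_eq p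
  rw [hp] at h1
  rw [norm_sq_eq z, norm_sq_eq (p - z), halfPlane, Complex.div_re, Complex.normSq_apply]
  simp only [Complex.add_re, Complex.sub_re, Complex.add_im, Complex.sub_im]
  rw [← add_div]
  congr 1
  · linear_combination -h1
  · ring

lemma halfPlane_im {p z : ℂ} :
    (halfPlane p z).im = 2 * (z.im * p.re - z.re * p.im) / ‖p - z‖ ^ 2 := by
  rw [norm_sq_eq (p - z), halfPlane, Complex.div_im, Complex.normSq_apply]
  simp only [Complex.add_re, Complex.sub_re, Complex.add_im, Complex.sub_im]
  rw [← sub_div]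
  congr 1 <;> ring

lemma ne_of_mem_disk {p z : ℂ} (hp : ‖p‖ = 1) (hz : z ∈ disk) : p ≠ z := by
  rintro rfl
  have := mem_disk_iff.1 hz
  linarith

lemma norm_sub_sq_pos {p z : ℂ} (hp : ‖p‖ = 1) (hz : z ∈ disk) : 0 < ‖p - z‖ ^ 2 := by
  have := sub_ne_zero.2 (ne_of_mem_disk hp hz)
  positivity

lemma halfPlane_re_pos {p z : ℂ} (hp : ‖p‖ = 1) (hz : z ∈ disk) : 0 < (halfPlane p z).re := by
  rw [halfPlane_re hp]
  exact div_pos (one_sub_norm_sq_pos hz) (norm_sub_sq_pos hp hz)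

lemma norm_halfPlane_sub {p z z' : ℂ} (hp : ‖p‖ = 1) (hz : p ≠ z) (hz' : p ≠ z') :
    ‖halfPlane p z - halfPlane p z'‖ = 2 * ‖z - z'‖ / (‖p - z‖ * ‖p - z'‖) := by
  have h1 := sub_ne_zero.2 hz
  have h2 := sub_ne_zero.2 hz'
  have : halfPlane p z - halfPlane p z' = 2 * p * (z - z') / ((p - z) * (p - z')) := by
    unfold halfPlane; field_simp; ring
  rw [this]
  simp [hp]

lemma halfPlane_inj {p z z' : ℂ} (hp : ‖p‖ = 1) (hz : p ≠ z) (hz' : p ≠ z')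
    (h : halfPlane p z = halfPlane p z') : z = z' := by
  have h0 := norm_halfPlane_sub hp hz hz'
  have h1 := sub_ne_zero.2 hz
  have h2 := sub_ne_zero.2 hz'
  rw [h, sub_self, norm_zero, eq_comm, div_eq_zero_iff] at h0
  rcases h0 with h0 | h0
  · exact sub_eq_zero.1 (norm_eq_zero.1 (by linarith))
  · simp [h1, h2] at h0

/-- The square norm of `halfPlane p z + 1 = 2 p / (p - z)`. -/
lemma halfPlane_normSq {p z : ℂ} (hp : ‖p‖ = 1) (hz : p ≠ z) :
    (halfPlane p z).im ^ 2 + ((halfPlane p z).re + 1) ^ 2 = 4 / ‖p - z‖ ^ 2 := by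
  have h1 := sub_ne_zero.2 hz
  have h2 : halfPlane p z + 1 = 2 * p / (p - z) := by
    unfold halfPlane; field_simp; ring
  have h3 := norm_sq_eq (halfPlane p z + 1)
  simp only [Complex.add_re, Complex.one_re, Complex.add_im, Complex.one_im, add_zero] at h3
  rw [add_comm, ← h3, h2, norm_div, norm_mul, hp, Complex.norm_ofNat, div_pow]
  norm_num

/-- The component of `n` along the unit tangent vector `i p` of the circle at `p`. -/
def slope (n p : ℂ) : ℝ := n.im * p.re - n.re * p.im

lemma edgeFun_ideal {k : ℝ} {n : ℂ} {c : ℝ} {p : ℂ} (hp : ‖p‖ = 1) :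
    edgeFun k n c p = 2 * (n.re * p.re + n.im * p.im - c) := by
  rw [edgeFun, hp]; ring

/-- If `p` is an ideal endpoint of the edge, the edge is a straight ray in the half plane at `p`. -/
lemma edgeFun_eq_halfPlane {k : ℝ} {n : ℂ} {c : ℝ} {p z : ℂ} (hp : ‖p‖ = 1) (hz : p ≠ z)
    (h : edgeFun k n c p = 0) :
    edgeFun k n c z = ‖p - z‖ ^ 2 *
      (k * (halfPlane p z).re + slope n p * (halfPlane p z).im - c) := by
  have h1 := sub_ne_zero.2 hz
  have h2 : ‖p - z‖ ^ 2 ≠ 0 := by positivity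
  rw [edgeFun_ideal hp] at h
  rw [halfPlane_re hp, halfPlane_im]
  have h3 := norm_sq_eq p
  rw [hp] at h3
  field_simp
  rw [edgeFun, slope, norm_sq_eq z, norm_sq_eq (p - z), Complex.sub_re, Complex.sub_im]
  linear_combination (z.re * p.re + z.im * p.im) * h + (2 * (n.re * z.re + n.im * z.im) - c) * h3

lemma slope_sq {k : ℝ} {n : ℂ} {c : ℝ} {p : ℂ} (hp : ‖p‖ = 1)
    (hn : n.re ^ 2 + n.im ^ 2 - c ^ 2 = 1 - k ^ 2) (h : edgeFun k n c p = 0) :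
    slope n p ^ 2 = 1 - k ^ 2 := by
  rw [edgeFun_ideal hp] at h
  have h3 := norm_sq_eq p
  rw [hp] at h3
  rw [slope]
  linear_combination hn - (n.re ^ 2 + n.im ^ 2) * h3
    - (n.re * p.re + n.im * p.im + c) / 2 * h

/-- In a non-horizontal strip of the half plane, the horizontal coordinate grows at most linearly in
the height. -/
lemma exists_bound_of_strip {k a K : ℝ} (ha : a ≠ 0) :
    ∃ B > 0, ∀ x y : ℝ, 0 < y → |k * y + a * x| ≤ K → |x| ≤ B * (y + 1) := by
  refine ⟨(|K| + |k|) / |a| + 1, by positivity, fun x y hy h => ?_⟩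
  have h1 : |a| * |x| ≤ |K| + |k| * y := by
    rw [← abs_mul]
    calc |a * x| = |(k * y + a * x) - k * y| := by ring_nf
      _ ≤ |k * y + a * x| + |k * y| := abs_sub _ _
      _ ≤ |K| + |k| * y := by
        rw [abs_mul, abs_of_pos hy]; linarith [le_abs_self K]
  have ha' : 0 < |a| := abs_pos.2 ha
  have h2 : |x| ≤ (|K| + |k| * y) / |a| := by
    rw [le_div_iff₀ ha']; linarith
  have h3 : (|K| + |k| * y) / |a| ≤ (|K| + |k|) / |a| * (y + 1) := by
    rw [div_mul_eq_mul_div, div_le_div_iff_of_pos_right ha']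
    nlinarith [abs_nonneg K, abs_nonneg k, mul_nonneg (abs_nonneg K) hy.le]
  nlinarith

/-- In a strip, height tends to infinity at the ideal point. -/
lemma exists_re_halfPlane_ge {k a K : ℝ} (ha : a ≠ 0) {p : ℂ} (hp : ‖p‖ = 1) :
    ∃ B > 0, ∀ z ∈ disk, |k * (halfPlane p z).re + a * (halfPlane p z).im| ≤ K →
      2 / ‖p - z‖ ≤ B * ((halfPlane p z).re + 1) := by
  obtain ⟨B, hB, h⟩ := exists_bound_of_strip (k := k) (K := K) ha
  refine ⟨B + 1, by positivity, fun z hz hK => ?_⟩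
  have hy := halfPlane_re_pos hp hz
  have h1 := h _ _ hy hK
  have h2 := halfPlane_normSq hp (ne_of_mem_disk hp hz)
  have h3 := norm_sub_sq_pos hp hz
  refine abs_le_of_sq_le_sq' ?_ (by positivity) |>.2
  rw [div_pow]
  norm_num
  rw [← h2]
  nlinarith [sq_abs (halfPlane p z).im, abs_nonneg (halfPlane p z).im,
    mul_self_le_mul_self (abs_nonneg _) h1, mul_pos hB (by linarith : 0 < (halfPlane p z).re + 1)]

/-- An edge is the whole zero set of its equation in the disk. In the half plane at `p` the zero set is a
ray, parametrized by its height; along the edge the height goes from infinity, at `p`, to zero, at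
`q`, and hence takes every value. -/
theorem IsHEdge.eq_setOf {H : ℝ} (hH : |H| < 1 / 2) {p q : ℂ} {Γ : Set ℂ} (hp : ‖p‖ = 1)
    (hq : ‖q‖ = 1) (hpq : p ≠ q) (hΓ : IsHEdge H p q Γ) :
    ∃ (k : ℝ) (n : ℂ) (c : ℝ), k ^ 2 = 4 * H ^ 2 ∧ n.re ^ 2 + n.im ^ 2 - c ^ 2 = 1 - k ^ 2 ∧
      edgeFun k n c p = 0 ∧ edgeFun k n c q = 0 ∧
      Γ = {z | z ∈ disk ∧ edgeFun k n c z = 0} := by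
  obtain ⟨k, γ, hk, hγ, hbot, htop, rfl⟩ := hΓ
  obtain ⟨n, c, hn, hF⟩ := exists_edgeFun_eq_zero hγ
  have hk2 : k ^ 2 = 4 * H ^ 2 := by rcases hk with rfl | rfl <;> ring
  have hk1 : k ^ 2 < 1 := by
    rw [hk2, ← sq_abs]; nlinarith [abs_nonneg H]
  have lim : ∀ {l : Filter ℝ} [NeBot l] {e : ℂ}, Tendsto γ l (𝓝 e) → edgeFun k n c e = 0 := by
    intro l _ e he
    have := ((continuous_edgeFun k n c).tendsto e).comp he
    exact tendsto_nhds_unique this (tendsto_const_nhds.congr fun s => (hF s).symm)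
  have hFp := lim hbot
  have hFq := lim htop
  have ha2 := slope_sq hp hn hFp
  set a := slope n p with ha_def
  have ha : a ≠ 0 := by
    intro h0; rw [h0] at ha2; nlinarith
  refine ⟨k, n, c, hk2, hn, hFp, hFq, ?_⟩
  ext z
  constructor
  · rintro ⟨s, rfl⟩
    exact ⟨hγ.mem_disk s, hF s⟩
  rintro ⟨hz, hFz⟩
  have line : ∀ w ∈ disk, edgeFun k n c w = 0 →
      k * (halfPlane p w).re + a * (halfPlane p w).im = c := fun w hw h0 => by
    rw [edgeFun_eq_halfPlane hp (ne_of_mem_disk hp hw) hFp] at h0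
    have := (mul_eq_zero.1 h0).resolve_left (norm_sub_sq_pos hp hw).ne'
    linarith
  have hcont : Continuous fun s => (halfPlane p (γ s)).re := by
    have : Continuous fun s => halfPlane p (γ s) :=
      (continuous_const.add hγ.contDiff.continuous).div
        (continuous_const.sub hγ.contDiff.continuous)
        fun s => sub_ne_zero.2 (ne_of_mem_disk hp (hγ.mem_disk s))
    exact Complex.continuous_re.comp this
  have hy := halfPlane_re_pos hp hz
  have hlow : ∃ s, (halfPlane p (γ s)).re ≤ (halfPlane p z).re := by
    have h1 : Tendsto (fun s => (halfPlane p (γ s)).re) atTop (𝓝 ((halfPlane p q).re)) := by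
      refine (Complex.continuous_re.tendsto _).comp ?_
      exact (tendsto_const_nhds.add htop).div (tendsto_const_nhds.sub htop) (sub_ne_zero.2 hpq)
    rw [halfPlane_re hp, hq] at h1
    norm_num at h1
    exact ((h1.eventually_lt_const hy).exists).imp fun _ h => h.le
  have hhigh : ∃ s, (halfPlane p z).re ≤ (halfPlane p (γ s)).re := by
    obtain ⟨B, hB, h1⟩ := exists_re_halfPlane_ge (k := k) (K := |c|) ha hp
    have h2 : Tendsto (fun s => ‖p - γ s‖) atBot (𝓝 0) := by
      have := (tendsto_const_nhds (x := p)).sub hbot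
      simpa using this.norm
    have hpos : 0 < 2 / (B * ((halfPlane p z).re + 1)) := by positivity
    obtain ⟨s, hs⟩ := (h2.eventually_lt_const hpos).exists
    refine ⟨s, ?_⟩
    have h3 := h1 (γ s) (hγ.mem_disk s) (by rw [line _ (hγ.mem_disk s) (hF s)])
    have h4 : 0 < ‖p - γ s‖ :=
      norm_pos_iff.2 (sub_ne_zero.2 (ne_of_mem_disk hp (hγ.mem_disk s)))
    rw [lt_div_iff₀ (by positivity)] at hs
    rw [div_le_iff₀ h4] at h3
    by_contra! hlt
    nlinarith [mul_lt_mul_of_pos_right hlt (mul_pos hB h4)]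
  obtain ⟨s, hs⟩ := mem_range_of_exists_le_of_exists_ge hcont hlow hhigh
  refine ⟨s, (halfPlane_inj hp (ne_of_mem_disk hp hz)
    (ne_of_mem_disk hp (hγ.mem_disk s)) (Complex.ext hs.symm ?_)).symm⟩
  have e1 := line _ hz hFz
  have e2 := line _ (hγ.mem_disk s) (hF s)
  simp only at hs
  rw [hs] at e2
  exact mul_left_cancel₀ ha (by linarith)

/-! ### Sides and vertices of an ideal polygon -/

/-- The hyperbolic distance in the half plane model: `sinh (hdist z z' / 2)` is
`|w - w'| / (2 √(Re w Re w'))`. -/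
lemma norm_halfPlane_sub_lt {p z z' : ℂ} {e : ℝ} (hp : ‖p‖ = 1) (hz : z ∈ disk) (hz' : z' ∈ disk)
    (h : hdist z z' < 2 * Real.arsinh e) :
    ‖halfPlane p z - halfPlane p z'‖ <
      2 * e * Real.sqrt ((halfPlane p z).re * (halfPlane p z').re) := by
  have h1 : ‖z - z'‖ / Real.sqrt ((1 - ‖z‖ ^ 2) * (1 - ‖z'‖ ^ 2)) < e := by
    unfold hdist at h
    exact Real.arsinh_lt_arsinh.1 (by linarith)
  have hD := one_sub_norm_sq_pos hz
  have hD' := one_sub_norm_sq_pos hz'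
  have hd : 0 < ‖p - z‖ := norm_pos_iff.2 (sub_ne_zero.2 (ne_of_mem_disk hp hz))
  have hd' : 0 < ‖p - z'‖ := norm_pos_iff.2 (sub_ne_zero.2 (ne_of_mem_disk hp hz'))
  rw [div_lt_iff₀ (by positivity)] at h1
  rw [norm_halfPlane_sub hp (ne_of_mem_disk hp hz) (ne_of_mem_disk hp hz'), halfPlane_re hp,
    halfPlane_re hp, div_mul_div_comm, ← mul_pow, Real.sqrt_div (by positivity),
    Real.sqrt_sq (by positivity), ← mul_div_assoc]
  apply div_lt_div_of_pos_right _ (by positivity)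
  linarith

/-- Two rays of the half plane that come arbitrarily close at infinity are parallel. -/
lemma ArbitrarilyCloseAt.parallel {p : ℂ} (hp : ‖p‖ = 1) {Γ Γ' : Set ℂ}
    (h : ArbitrarilyCloseAt p Γ Γ') {k a c k' a' c' : ℝ} (ha : a ≠ 0) (ha' : a' ≠ 0)
    (hΓ : ∀ z ∈ Γ, z ∈ disk ∧ k * (halfPlane p z).re + a * (halfPlane p z).im = c)
    (hΓ' : ∀ z ∈ Γ', z ∈ disk ∧ k' * (halfPlane p z).re + a' * (halfPlane p z).im = c') :
    k * a' = k' * a := by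
  by_contra hne
  have hδ : 0 < |k / a - k' / a'| := by
    rw [abs_pos, sub_ne_zero]
    intro h0
    rw [div_eq_div_iff ha ha'] at h0
    exact hne h0
  obtain ⟨δ, hδd⟩ : ∃ δ, δ = |k / a - k' / a'| := ⟨_, rfl⟩
  rw [← hδd] at hδ
  set M := 1 + |k' / a'| with hM
  have hMpos : 0 < M := by positivity
  set K := |c / a - c' / a'| with hK
  have hK0 : 0 ≤ K := abs_nonneg _
  set e := min (1 / 4) (δ / (16 * M)) with he
  have he0 : 0 < e := by positivity
  have he1 : e ≤ 1 / 4 := min_le_left _ _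
  have he2 : 16 * M * e ≤ δ := by
    have : e ≤ δ / (16 * M) := min_le_right _ _
    rw [le_div_iff₀ (by positivity)] at this; linarith
  obtain ⟨B, hB, hBh⟩ := exists_re_halfPlane_ge (k := k) (K := |c|) ha hp
  set Y := 2 * K / δ + 1 with hY
  have hY0 : 0 < Y := by positivity
  have hr : 0 < 2 / (B * (Y + 1)) := by positivity
  have ev : ∀ᶠ q in 𝓝[Γ] p ×ˢ 𝓝[Γ'] p,
      (q.1 ∈ Γ ∧ q.1 ∈ ball p (2 / (B * (Y + 1)))) ∧ q.2 ∈ Γ' :=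
    (Filter.Eventually.and self_mem_nhdsWithin
      (mem_nhdsWithin_of_mem_nhds (ball_mem_nhds _ hr))).prod_mk
      (self_mem_nhdsWithin (a := p) (s := Γ'))
  obtain ⟨⟨z, z'⟩, hdz, ⟨hzΓ, hzb⟩, hzΓ'⟩ :=
    ((h (2 * Real.arsinh e) (by simpa using he0)).and_eventually ev).exists
  simp only at hdz hzΓ hzb hzΓ'
  obtain ⟨hz, hline⟩ := hΓ z hzΓ
  obtain ⟨hz', hline'⟩ := hΓ' z' hzΓ'
  have hw := norm_halfPlane_sub_lt hp hz hz' hdz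
  have hy := halfPlane_re_pos hp hz
  have hy' := halfPlane_re_pos hp hz'
  have hYy : Y ≤ (halfPlane p z).re := by
    have h1 := hBh z hz (by rw [hline])
    have h4 : 0 < ‖p - z‖ := norm_pos_iff.2 (sub_ne_zero.2 (ne_of_mem_disk hp hz))
    rw [mem_ball, dist_comm, dist_eq_norm, lt_div_iff₀ (by positivity)] at hzb
    rw [div_le_iff₀ h4] at h1
    by_contra! hlt
    nlinarith [mul_lt_mul_of_pos_right hlt (mul_pos hB h4)]
  have hx1 := (Complex.abs_im_le_norm _).trans_lt hw
  have hy1 := (Complex.abs_re_le_norm _).trans_lt hw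
  rw [Complex.sub_im] at hx1
  rw [Complex.sub_re] at hy1
  generalize (halfPlane p z).re = y at *
  generalize (halfPlane p z).im = x at *
  generalize (halfPlane p z').re = y' at *
  generalize (halfPlane p z').im = x' at *
  obtain ⟨r, hrd⟩ : ∃ r, r = Real.sqrt (y * y') := ⟨_, rfl⟩
  have hr0 : 0 ≤ r := hrd ▸ Real.sqrt_nonneg _
  have hr2 : r ^ 2 = y * y' := by rw [hrd, Real.sq_sqrt (by positivity)]
  rw [← hrd] at hx1 hy1
  have hry : r ≤ 2 * y := by
    have h1 : y' ≤ y + r / 2 := by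
      have := (abs_lt.1 hy1).1
      nlinarith
    by_contra! hlt
    nlinarith
  have hx2 : |x - x'| ≤ 4 * e * y := by nlinarith
  have hy2 : |y - y'| ≤ 4 * e * y := by nlinarith
  have hid : (k / a - k' / a') * y = (c / a - c' / a') - (x - x') - k' / a' * (y - y') := by
    rw [← hline, ← hline']; field_simp; ring
  have hfin : δ * y ≤ K + 4 * e * y * M := by
    calc δ * y = |(k / a - k' / a') * y| := by rw [abs_mul, hδd, abs_of_pos hy]
      _ ≤ |c / a - c' / a'| + |x - x'| + |k' / a' * (y - y')| := by
        rw [hid]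
        exact (abs_sub _ _).trans (add_le_add_left (abs_sub _ _) _)
      _ ≤ K + 4 * e * y + |k' / a'| * (4 * e * y) := by
        rw [abs_mul]; gcongr
      _ = K + 4 * e * y * M := by rw [hM]; ring
  have h5 : 2 * K + δ ≤ δ * y := by
    calc 2 * K + δ = δ * Y := by rw [hY]; field_simp
      _ ≤ δ * y := by gcongr
  nlinarith [mul_le_mul_of_nonneg_right he2 hy.le]

/-- `edgeFun k n c = 0` is an equation of an edge: `Γ` is the part of the zero set of `edgeFun k n c` in the disk,
and `p`, `q` are its ideal endpoints. -/
structure IsEdgeEquation (H : ℝ) (p q : ℂ) (Γ : Set ℂ) (k : ℝ) (n : ℂ) (c : ℝ) : Prop where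
  k_sq : k ^ 2 = 4 * H ^ 2
  normSq : n.re ^ 2 + n.im ^ 2 - c ^ 2 = 1 - k ^ 2
  left : edgeFun k n c p = 0
  right : edgeFun k n c q = 0
  eq_setOf : Γ = {z | z ∈ disk ∧ edgeFun k n c z = 0}

lemma edgeFun_neg (k : ℝ) (n : ℂ) (c : ℝ) (z : ℂ) :
    edgeFun (-k) (-n) (-c) z = -edgeFun k n c z := by
  simp only [edgeFun, Complex.neg_re, Complex.neg_im]; ring

lemma IsEdgeEquation.neg {H : ℝ} {p q : ℂ} {Γ : Set ℂ} {k : ℝ} {n : ℂ} {c : ℝ}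
    (h : IsEdgeEquation H p q Γ k n c) : IsEdgeEquation H p q Γ (-k) (-n) (-c) where
  k_sq := by rw [neg_sq, h.k_sq]
  normSq := by simpa using h.normSq
  left := by rw [edgeFun_neg, h.left, neg_zero]
  right := by rw [edgeFun_neg, h.right, neg_zero]
  eq_setOf := by simp only [edgeFun_neg, neg_eq_zero]; exact h.eq_setOf

lemma fin_ne_add_one {n : ℕ} [NeZero n] (hn : 2 ≤ n) (j : Fin n) : j ≠ j + 1 := by
  obtain ⟨m, rfl⟩ := Nat.exists_eq_add_of_le' hn
  intro h
  have : (1 : Fin (m + 2)) = 0 := by simpa using h.symm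
  simp at this

/-- Since the domain is connected and disjoint from the edge, the equation of the edge can be chosen
positive on the domain. -/
lemma exists_edge_equation {H : ℝ} (hH : |H| < 1 / 2) {n : ℕ} [NeZero n] {p : Fin n → ℂ}
    {Γ : Fin n → Set ℂ} (hpoly : IsIdealHPolygon H p Γ) {Ω : Set ℂ} (hΩ : IsDomainOfDisk Ω)
    (hbd : hbdry Ω = ⋃ i, Γ i) (j : Fin n) :
    ∃ (k : ℝ) (ν : ℂ) (c : ℝ), IsEdgeEquation H (p j) (p (j + 1)) (Γ j) k ν c ∧
      (∀ z ∈ Ω, 0 < edgeFun k ν c z) ∧ (∀ z ∈ closure Ω, 0 ≤ edgeFun k ν c z) := by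
  obtain ⟨k, ν, c, h1, h2, h3, h4, h7⟩ := (hpoly.edge j).eq_setOf hH (hpoly.vertex_ideal j)
    (hpoly.vertex_ideal _) fun h => fin_ne_add_one hpoly.two_le j (hpoly.vertex_injective h)
  have hE : IsEdgeEquation H (p j) (p (j + 1)) (Γ j) k ν c := ⟨h1, h2, h3, h4, h7⟩
  obtain ⟨hopen, hconn, hsub⟩ := hΩ
  suffices ∃ (k : ℝ) (ν : ℂ) (c : ℝ), IsEdgeEquation H (p j) (p (j + 1)) (Γ j) k ν c ∧
      (∀ z ∈ Ω, 0 < edgeFun k ν c z) by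
    obtain ⟨k, ν, c, h, hpos⟩ := this
    refine ⟨k, ν, c, h, hpos, fun z hz => ?_⟩
    have : closure Ω ⊆ {z | 0 ≤ edgeFun k ν c z} :=
      closure_minimal (fun z hz => (hpos z hz).le)
        (isClosed_le continuous_const (continuous_edgeFun _ _ _))
    exact this hz
  have hne : ∀ z ∈ Ω, edgeFun k ν c z ≠ 0 := fun z hz h0 => by
    have hzΓ : z ∈ Γ j := by rw [h7]; exact ⟨hsub hz, h0⟩
    have : z ∈ hbdry Ω := by rw [hbd]; exact Set.mem_iUnion_of_mem j hzΓ
    have := this.1.2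
    rw [hopen.interior_eq] at this
    exact this hz
  obtain ⟨z₀, hz₀⟩ := hconn.nonempty
  have hcont := (continuous_edgeFun k ν c).continuousOn (s := Ω)
  rcases (hne z₀ hz₀).lt_or_gt with hlt | hgt
  · refine ⟨-k, -ν, -c, hE.neg, fun z hz => ?_⟩
    rw [edgeFun_neg, neg_pos]
    by_contra! h0
    obtain ⟨w, hw, hw0⟩ := hconn.isPreconnected.intermediate_value hz₀ hz hcont ⟨hlt.le, h0⟩
    exact hne w hw hw0
  · refine ⟨k, ν, c, hE, fun z hz => ?_⟩
    by_contra! h0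
    obtain ⟨w, hw, hw0⟩ := hconn.isPreconnected.intermediate_value hz hz₀ hcont ⟨h0, hgt.le⟩
    exact hne w hw hw0

/-- At a common vertex where they come arbitrarily close, two edges bounding the domain are
parallel rays with opposite inner sides. -/
lemma opposite_at_vertex {H : ℝ} (hH : |H| < 1 / 2) {p q q' : ℂ} (hp : ‖p‖ = 1) {Γ Γ' : Set ℂ}
    {k k' c c' : ℝ} {n n' : ℂ} (h : IsEdgeEquation H q p Γ k n c)
    (h' : IsEdgeEquation H p q' Γ' k' n' c') (hclose : ArbitrarilyCloseAt p Γ Γ')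
    (hne : Γ.Nonempty) (hne' : Γ'.Nonempty) (hdisj : Disjoint Γ Γ')
    (hpos : ∀ z ∈ Γ', 0 ≤ edgeFun k n c z) (hpos' : ∀ z ∈ Γ, 0 ≤ edgeFun k' n' c' z) :
    k' = -k ∧ slope n' p = -slope n p ∧ k ^ 2 + slope n p ^ 2 = 1 ∧ slope n p ≠ 0 := by
  have hk1 : 4 * H ^ 2 < 1 := by rw [← sq_abs]; nlinarith [abs_nonneg H]
  have ha2 := slope_sq hp h.normSq h.right
  have ha2' := slope_sq hp h'.normSq h'.left
  have hk := h.k_sq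
  have hk' := h'.k_sq
  have F := fun z (hz : z ∈ disk) => edgeFun_eq_halfPlane hp (ne_of_mem_disk hp hz) h.right
  have F' := fun z (hz : z ∈ disk) => edgeFun_eq_halfPlane hp (ne_of_mem_disk hp hz) h'.left
  have mem : ∀ z, z ∈ Γ ↔ z ∈ disk ∧ edgeFun k n c z = 0 := fun z => by rw [h.eq_setOf]; rfl
  have mem' : ∀ z, z ∈ Γ' ↔ z ∈ disk ∧ edgeFun k' n' c' z = 0 := fun z => by
    rw [h'.eq_setOf]; rfl
  set a := slope n p
  set a' := slope n' p
  have ha : a ≠ 0 := fun h0 => by rw [h0] at ha2; nlinarith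
  have ha' : a' ≠ 0 := fun h0 => by rw [h0] at ha2'; nlinarith
  have line : ∀ z ∈ Γ, z ∈ disk ∧ k * (halfPlane p z).re + a * (halfPlane p z).im = c :=
    fun z hz => by
      obtain ⟨hz, h0⟩ := (mem z).1 hz
      rw [F z hz] at h0
      exact ⟨hz, by linarith [(mul_eq_zero.1 h0).resolve_left (norm_sub_sq_pos hp hz).ne']⟩
  have line' : ∀ z ∈ Γ', z ∈ disk ∧ k' * (halfPlane p z).re + a' * (halfPlane p z).im = c' :=
    fun z hz => by
      obtain ⟨hz, h0⟩ := (mem' z).1 hz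
      rw [F' z hz] at h0
      exact ⟨hz, by linarith [(mul_eq_zero.1 h0).resolve_left (norm_sub_sq_pos hp hz).ne']⟩
  have hpar := hclose.parallel hp ha ha' line line'
  have hdot : (k * k' + a * a' - 1) * (k * k' + a * a' + 1) = 0 := by
    linear_combination (k' ^ 2 + a' ^ 2) * ha2 + ha2' - (k * a' - k' * a) * hpar
  rcases mul_eq_zero.1 hdot with h1 | h1
  -- With equal inner sides, each ray would lie on the inner side of the other
  -- one, and the two edges would coincide.
  · exfalso
    have hs : (k - k') ^ 2 + (a - a') ^ 2 = 0 := by linear_combination -2 * h1 + ha2 + ha2'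
    have e1 : k' = k := by nlinarith [sq_nonneg (k - k'), sq_nonneg (a - a')]
    have e2 : a' = a := by nlinarith [sq_nonneg (k - k'), sq_nonneg (a - a')]
    obtain ⟨z, hz⟩ := hne
    obtain ⟨z', hz'⟩ := hne'
    have i1 := hpos' z hz
    have i2 := hpos z' hz'
    obtain ⟨hzd, hl⟩ := line z hz
    obtain ⟨hzd', hl'⟩ := line' z' hz'
    rw [F' z hzd, mul_nonneg_iff_of_pos_left (norm_sub_sq_pos hp hzd), e1, e2] at i1
    rw [F z' hzd', mul_nonneg_iff_of_pos_left (norm_sub_sq_pos hp hzd')] at i2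
    rw [e1, e2] at hl'
    have e3 : c' = c := by linarith
    refine Set.disjoint_left.1 hdisj hz ((mem' z).2 ⟨hzd, ?_⟩)
    rw [F' z hzd, e1, e2, hl, e3, sub_self, mul_zero]
  · have hs : (k + k') ^ 2 + (a + a') ^ 2 = 0 := by linear_combination 2 * h1 + ha2 + ha2'
    refine ⟨?_, ?_, by linarith, ha⟩
    · nlinarith [sq_nonneg (k + k'), sq_nonneg (a + a')]
    · nlinarith [sq_nonneg (k + k'), sq_nonneg (a + a')]

lemma slope_decomp {k : ℝ} {n : ℂ} {c : ℝ} {p : ℂ} (hp : ‖p‖ = 1) (h : edgeFun k n c p = 0) :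
    n = (c + slope n p * Complex.I) * p := by
  rw [edgeFun_ideal hp] at h
  have h3 := norm_sq_eq p
  rw [hp] at h3
  apply Complex.ext
  · simp [slope]
    linear_combination n.re * h3 + p.re * h / 2
  · simp [slope]
    linear_combination n.im * h3 + p.im * h / 2

/-- On the unit circle, in the coordinate `Im (halfPlane q e)` of the ideal boundary, `edgeFun` is a
quadratic polynomial divided by `1 + Im (halfPlane q e) ²`. -/
lemma ideal_quadratic {k : ℝ} {n : ℂ} {c : ℝ} {q e : ℂ} (hq : ‖q‖ = 1) (he : ‖e‖ = 1)
    (hqe : q ≠ e) :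
    edgeFun k n c e * (1 + (halfPlane q e).im ^ 2) =
      edgeFun k n c q * (halfPlane q e).im ^ 2 + 4 * slope n q * (halfPlane q e).im
        - 2 * (n.re * q.re + n.im * q.im + c) := by
  have h1 := sub_ne_zero.2 hqe
  have h2 : ‖q - e‖ ^ 2 ≠ 0 := by positivity
  have h3 := halfPlane_normSq hq hqe
  rw [halfPlane_re hq, he] at h3
  have h4 : (1 + (halfPlane q e).im ^ 2) * ‖q - e‖ ^ 2 = 4 := by
    rw [one_pow, sub_self, zero_div, zero_add, one_pow, eq_div_iff h2] at h3
    linarith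
  have h5 : (halfPlane q e).im * ‖q - e‖ ^ 2 = 2 * (e.im * q.re - e.re * q.im) := by
    rw [halfPlane_im]; field_simp
  have hq2 := norm_sq_eq q
  have he2 := norm_sq_eq e
  rw [hq] at hq2
  rw [he] at he2
  rw [edgeFun_ideal he, edgeFun_ideal hq, slope]
  have hd := norm_sq_eq (q - e)
  rw [Complex.sub_re, Complex.sub_im] at hd
  apply mul_right_cancel₀ h2
  generalize (halfPlane q e).im = x at *
  generalize ‖q - e‖ ^ 2 = d at *
  have hd' : d = 2 - 2 * (q.re * e.re + q.im * e.im) := by linear_combination hd - hq2 - he2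
  have hne : n.re * e.re + n.im * e.im = (n.re * q.re + n.im * q.im) * (q.re * e.re + q.im * e.im)
      + (n.im * q.re - n.re * q.im) * (e.im * q.re - e.re * q.im) := by
    linear_combination (n.re * e.re + n.im * e.im) * hq2
  rw [hne]
  generalize n.re * q.re + n.im * q.im = A at *
  generalize n.im * q.re - n.re * q.im = B at *
  linear_combination (2 * (A * (q.re * e.re + q.im * e.im) + B * (e.im * q.re - e.re * q.im) - c)
    - 2 * (A - c)) * h4 - 4 * B * h5 + 4 * A * hd'

/-- The roots of the quadratic polynomial of `ideal_quadratic` are the ideal endpoints of the edge. -/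
lemma ideal_factor {k : ℝ} {n : ℂ} {c : ℝ} {q p p' e : ℂ} (hq : ‖q‖ = 1) (hp : ‖p‖ = 1)
    (hp' : ‖p'‖ = 1) (he : ‖e‖ = 1) (hqp : q ≠ p) (hqp' : q ≠ p') (hqe : q ≠ e) (hpp' : p ≠ p')
    (h : edgeFun k n c p = 0) (h' : edgeFun k n c p' = 0) :
    edgeFun k n c e * (1 + (halfPlane q e).im ^ 2) = edgeFun k n c q *
      ((halfPlane q e).im - (halfPlane q p).im) * ((halfPlane q e).im - (halfPlane q p').im) := by
  have e1 := ideal_quadratic (k := k) (n := n) (c := c) hq hp hqp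
  have e2 := ideal_quadratic (k := k) (n := n) (c := c) hq hp' hqp'
  have e3 := ideal_quadratic (k := k) (n := n) (c := c) hq he hqe
  rw [h, zero_mul] at e1
  rw [h', zero_mul] at e2
  have hx : (halfPlane q p).im - (halfPlane q p').im ≠ 0 := by
    intro h0
    apply hpp'
    refine halfPlane_inj hq hqp hqp' (Complex.ext ?_ (by linarith))
    rw [halfPlane_re hq, halfPlane_re hq, hp, hp']; simp
  rw [e3]
  generalize (halfPlane q p).im = x at *
  generalize (halfPlane q p').im = x' at *
  generalize (halfPlane q e).im = y at *
  generalize edgeFun k n c q = α at *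
  generalize slope n q = β at *
  generalize n.re * q.re + n.im * q.im + c = g at *
  have s1 : α * (x + x') + 4 * β = 0 := by
    apply mul_left_cancel₀ hx
    linear_combination e2 - e1
  linear_combination y * s1 - x * s1 - e1

/-- An ideal point `q` which is not a vertex lies strictly on the outer side of some edge. Otherwise, in
the coordinate of the ideal boundary sending `q` to infinity, no vertex lies strictly between the
endpoints of an edge; but the two neighbours of the greatest vertex, which are distinct since there
are at least three vertices, would then have to coincide. -/
lemma exists_edgeFun_neg {H : ℝ} (hH : |H| < 1 / 2) {n : ℕ} [NeZero n] (hn : 3 ≤ n)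
    {p : Fin n → ℂ} {Γ : Fin n → Set ℂ} (hp : ∀ i, ‖p i‖ = 1) (hinj : Function.Injective p)
    {k : Fin n → ℝ} {ν : Fin n → ℂ} {c : Fin n → ℝ}
    (hE : ∀ j, IsEdgeEquation H (p j) (p (j + 1)) (Γ j) (k j) (ν j) (c j))
    (hpos : ∀ i j, 0 ≤ edgeFun (k j) (ν j) (c j) (p i)) {q : ℂ} (hq : ‖q‖ = 1)
    (hqp : ∀ i, q ≠ p i) : ∃ j, edgeFun (k j) (ν j) (c j) q < 0 := by
  by_contra! hall
  have hk1 : 4 * H ^ 2 < 1 := by rw [← sq_abs]; nlinarith [abs_nonneg H]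
  have hpp : ∀ j, p j ≠ p (j + 1) := fun j h =>
    fin_ne_add_one (by omega) j (hinj h)
  have hqpos : ∀ j, 0 < edgeFun (k j) (ν j) (c j) q := fun j => by
    refine (hall j).lt_of_ne fun h0 => ?_
    have hj := hE j
    have hf := fun e (he : ‖e‖ = 1) (hqe : q ≠ e) => ideal_factor (e := e) hq (hp j) (hp (j + 1))
      he (hqp j) (hqp _) hqe (hpp j) hj.left hj.right
    -- If it vanished at `q` too, the equation would vanish on the whole circle; evaluating it at
    -- `-q` and `i q` gives `(c, n) = 0`, which is impossible since `k² < 1`.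
    have hm : ‖-q‖ = 1 := by rw [norm_neg, hq]
    have hqm : q ≠ -q := fun h => by
      have : q = 0 := self_eq_neg.1 h
      simp [this] at hq
    have hI : ‖Complex.I * q‖ = 1 := by simp [hq]
    have hqI : q ≠ Complex.I * q := fun h => by
      have h1 : (1 - Complex.I) * q = 0 := by linear_combination h
      rcases mul_eq_zero.1 h1 with h2 | h2
      · have := congrArg Complex.re h2; simp at this
      · simp [h2] at hq
    have z1 := hf _ hm hqm
    have z2 := hf _ hI hqI
    rw [← h0, zero_mul, zero_mul] at z1 z2
    have z1 := (mul_eq_zero.1 z1).resolve_right (by positivity)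
    have z2 := (mul_eq_zero.1 z2).resolve_right (by positivity)
    rw [edgeFun_ideal hm] at z1
    rw [edgeFun_ideal hI] at z2
    rw [edgeFun_ideal hq] at h0
    simp at z1 z2
    have hq2 := norm_sq_eq q
    rw [hq] at hq2
    have hc : c j = 0 := by linarith
    have hA : (ν j).re * q.re + (ν j).im * q.im = 0 := by linarith
    have hB : -((ν j).re * q.im) + (ν j).im * q.re = 0 := by linarith
    have hnn := hj.normSq
    have : (ν j).re ^ 2 + (ν j).im ^ 2 = 0 := by
      linear_combination ((ν j).re ^ 2 + (ν j).im ^ 2) * hq2 +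
        ((ν j).re * q.re + (ν j).im * q.im) * hA + (-((ν j).re * q.im) + (ν j).im * q.re) * hB
    rw [this, hc, hj.k_sq] at hnn
    linarith
  set x : Fin n → ℝ := fun i => (halfPlane q (p i)).im with hx
  have key : ∀ i j, 0 ≤ (x i - x j) * (x i - x (j + 1)) := fun i j => by
    have h1 := ideal_factor hq (hp j) (hp (j + 1)) (hp i) (hqp j) (hqp _) (hqp i) (hpp j)
      (hE j).left (hE j).right
    have h2 := mul_nonneg (hpos i j) (by positivity : 0 ≤ 1 + (halfPlane q (p i)).im ^ 2)
    rw [h1, mul_assoc] at h2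
    exact (mul_nonneg_iff_of_pos_left (hqpos j)).1 h2
  have xinj : ∀ i j, x i = x j → i = j := fun i j h => by
    apply hinj
    refine halfPlane_inj hq (hqp i) (hqp j) (Complex.ext ?_ h)
    rw [halfPlane_re hq, halfPlane_re hq, hp, hp]; simp
  obtain ⟨m, hm⟩ := Finite.exists_max x
  obtain ⟨l, rfl⟩ : ∃ l, m = l + 1 := ⟨m - 1, by simp⟩
  have hl : x l < x (l + 1) := (hm l).lt_of_ne fun h =>
    fin_ne_add_one (by omega) l (xinj _ _ h)
  have hr : x (l + 1 + 1) < x (l + 1) := (hm _).lt_of_ne fun h =>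
    fin_ne_add_one (by omega) (l + 1) (xinj _ _ h.symm)
  have k1 := key l (l + 1)
  have k2 := key (l + 1 + 1) l
  have heq : x l = x (l + 1 + 1) := by
    apply le_antisymm <;> nlinarith
  have := xinj _ _ heq
  obtain ⟨m, rfl⟩ := Nat.exists_eq_add_of_le' hn
  rw [add_assoc, left_eq_add, Fin.ext_iff] at this
  simp [Fin.val_add] at this
  have h2 : (2 : ℕ) % (m + 3) = 2 := Nat.mod_eq_of_lt (by omega)
  omega

/-! ### The ends of the domain -/

/-- The ideal boundary of the domain consists of the vertices, and near each vertex the domain is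
contained in a strip of the half plane, bounded by two parallel rays. -/
theorem IsIdealHPolygon.ends {H : ℝ} (hH : |H| < 1 / 2) {n : ℕ} [NeZero n] {p : Fin n → ℂ}
    {Γ : Fin n → Set ℂ} (hpoly : IsIdealHPolygon H p Γ)
    (hclose : ∀ i : Fin n, ArbitrarilyCloseAt (p (i + 1)) (Γ i) (Γ (i + 1)))
    {Ω : Set ℂ} (hΩ : IsDomainOfDisk Ω) (hbd : hbdry Ω = ⋃ i, Γ i) :
    (∀ j, ∃ k a K : ℝ, k ^ 2 + a ^ 2 = 1 ∧ a ≠ 0 ∧ ∀ z ∈ Ω,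
      |k * (halfPlane (p j) z).re + a * (halfPlane (p j) z).im| ≤ K) ∧
    ∀ q, ‖q‖ = 1 → (∀ i, q ≠ p i) → q ∉ closure Ω := by
  choose k ν c hE hpos hnn using exists_edge_equation hH hpoly hΩ hbd
  have hp := hpoly.vertex_ideal
  have hΓne : ∀ j, (Γ j).Nonempty := fun j => by
    obtain ⟨-, γ, -, -, -, -, h⟩ := hpoly.edge j
    rw [← h]; exact Set.range_nonempty _
  have hΓcl : ∀ j, Γ j ⊆ closure Ω := fun j z hz => by
    have : z ∈ hbdry Ω := by rw [hbd]; exact Set.mem_iUnion_of_mem j hz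
    exact this.1.1
  have hpcl : ∀ j, p j ∈ closure Ω := fun j => by
    obtain ⟨-, γ, -, -, h, -, hr⟩ := hpoly.edge j
    exact isClosed_closure.mem_of_tendsto h
      (Eventually.of_forall fun s => hΓcl j (hr ▸ Set.mem_range_self s))
  have hdisj : ∀ j, Disjoint (Γ j) (Γ (j + 1)) := fun j =>
    hpoly.edge_disjoint (fin_ne_add_one hpoly.two_le j)
  have hopp := fun j => opposite_at_vertex hH (hp (j + 1)) (hE j) (hE (j + 1)) (hclose j)
    (hΓne j) (hΓne _) (hdisj j) (fun z hz => hnn j z (hΓcl _ hz))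
    (fun z hz => hnn (j + 1) z (hΓcl _ hz))
  have hn3 : 3 ≤ n := by
    -- For two edges, opposite inner sides at both vertices force the edges to coincide.
    by_contra! hlt
    obtain rfl : n = 2 := by have := hpoly.two_le; omega
    have hsum : ∀ j, ν j + ν (j + 1) = (c j + c (j + 1)) * p (j + 1) := fun j => by
      have e1 := slope_decomp (hp (j + 1)) (hE j).right
      have e2 := slope_decomp (hp (j + 1)) (hE (j + 1)).left
      rw [(hopp j).2.1] at e2
      push_cast at e2
      linear_combination e1 + e2
    have h0 := hsum 0
    have h1 := hsum 1
    have i0 : (0 : Fin 2) + 1 = 1 := rfl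
    have i1 : (1 : Fin 2) + 1 = 0 := rfl
    rw [i0] at h0
    rw [i1] at h1
    have hp01 : p 0 - p 1 ≠ 0 := sub_ne_zero.2 fun h => by
      have := hpoly.vertex_injective h
      simp at this
    have hc : ((c 0 : ℂ) + c 1) = 0 := by
      apply mul_right_cancel₀ hp01
      linear_combination h0 - h1
    rw [hc, zero_mul] at h0
    have hν : ν 1 = -ν 0 := by linear_combination h0
    have hc' : c 1 = -c 0 := by
      have : c 0 + c 1 = 0 := by exact_mod_cast hc
      linarith
    have hk : k 1 = -k 0 := (hopp 0).1
    have : Γ 0 = Γ 1 := by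
      have e := (hE 1).neg.eq_setOf
      rw [hν, hc', hk, neg_neg, neg_neg, neg_neg] at e
      rw [(hE 0).eq_setOf, e]
    have hd := hdisj 0
    rw [i0, ← this, disjoint_self] at hd
    exact (hΓne 0).ne_empty hd
  refine ⟨fun j => ?_, fun q hq hqp hcl => ?_⟩
  · obtain ⟨j, rfl⟩ : ∃ l, j = l + 1 := ⟨j - 1, by simp⟩
    obtain ⟨h1, h2, h3, h4⟩ := hopp j
    refine ⟨k j, slope (ν j) (p (j + 1)), max |c j| |c (j + 1)|, h3, h4, fun z hz => ?_⟩
    have hzd := hΩ.2.2 hz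
    have i1 := hpos j z hz
    have i2 := hpos (j + 1) z hz
    have hne := ne_of_mem_disk (hp (j + 1)) hzd
    have hsq := norm_sub_sq_pos (hp (j + 1)) hzd
    rw [edgeFun_eq_halfPlane (hp (j + 1)) hne (hE j).right, mul_pos_iff_of_pos_left hsq] at i1
    rw [edgeFun_eq_halfPlane (hp (j + 1)) hne (hE (j + 1)).left, mul_pos_iff_of_pos_left hsq,
      h1, h2] at i2
    rw [abs_le]
    constructor
    · have := neg_abs_le (c j)
      have := le_max_left |c j| |c (j + 1)|
      linarith
    · have := neg_abs_le (c (j + 1))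
      have := le_max_right |c j| |c (j + 1)|
      linarith
  · obtain ⟨j, hj⟩ := exists_edgeFun_neg hH hn3 hp hpoly.vertex_injective hE
      (fun i j => hnn j _ (hpcl i)) hq hqp
    exact absurd (hnn j q hcl) (not_le.2 hj)

open MeasureTheory in
/-- The volume of a rotated rectangle centred at `p`. -/
lemma volume_rotated_rectangle_le {u : ℂ} (hu : ‖u‖ = 1) (p : ℂ) (r t : ℝ) :
    volume {z : ℂ | ‖p - z‖ ≤ r ∧ |(u * (p - z)).re| ≤ t} ≤
      ENNReal.ofReal (2 * t) * ENNReal.ofReal (2 * r) := by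
  set T : ℂ → ℂ := fun z => rotation (⟨u, by simp [Submonoid.unitSphere, hu]⟩ : Circle) (p - z)
  have hT : MeasurePreserving T volume volume :=
    (LinearIsometryEquiv.measurePreserving _).comp (Measure.measurePreserving_sub_left volume p)
  have hrect : volume (Set.Icc (-t) t ×ℂ Set.Icc (-r) r) =
      ENNReal.ofReal (2 * t) * ENNReal.ofReal (2 * r) := by
    have h1 := Complex.volume_preserving_equiv_real_prod.measure_preimage
      ((measurableSet_Icc.prod measurableSet_Icc).nullMeasurableSet
        (s := Set.Icc (-t) t ×ˢ Set.Icc (-r) r))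
    rw [Measure.volume_eq_prod, Measure.prod_prod, Real.volume_Icc, Real.volume_Icc] at h1
    rw [show 2 * t = t - -t by ring, show 2 * r = r - -r by ring, ← h1]
    rfl
  have hmeas : MeasurableSet (Set.Icc (-t) t ×ℂ Set.Icc (-r) r) :=
    (Complex.measurable_re measurableSet_Icc).inter (Complex.measurable_im measurableSet_Icc)
  rw [← hrect, ← hT.measure_preimage hmeas.nullMeasurableSet]
  refine measure_mono fun z hz => ?_
  have hTz : T z = u * (p - z) := rotation_apply _ _
  have h2 := (Complex.abs_im_le_norm (u * (p - z)))
  rw [norm_mul, hu, one_mul] at h2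
  change T z ∈ Set.Icc (-t) t ×ℂ Set.Icc (-r) r
  rw [hTz, Complex.mem_reProdIm]
  exact ⟨abs_le.1 hz.2, abs_le.1 (h2.trans hz.1)⟩

lemma halfPlane_strip_eq {p z : ℂ} (hp : ‖p‖ = 1) (hz : p ≠ z) (k a : ℝ) :
    2 * ((k + a * Complex.I) * conj p * (p - z)).re =
      (k * (halfPlane p z).re + a * (halfPlane p z).im + k) * ‖p - z‖ ^ 2 := by
  have h1 := sub_ne_zero.2 hz
  have h2 : ‖p - z‖ ^ 2 ≠ 0 := by positivity
  rw [halfPlane_re hp, halfPlane_im]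
  field_simp
  have hp2 := norm_sq_eq p
  rw [hp] at hp2
  rw [norm_sq_eq z, norm_sq_eq (p - z), Complex.sub_re, Complex.sub_im]
  simp
  linear_combination -k * hp2

/-- In a strip of the half plane at `p`, near `p`, the distance of `z` to `p` is comparable with
the distance to the circle, and `z` is quadratically close to a line. -/
lemma strip_estimate {p : ℂ} (hp : ‖p‖ = 1) {k a K : ℝ} (hka : k ^ 2 + a ^ 2 = 1) (ha : a ≠ 0) :
    ∃ B > 0, ∃ K' > 0, ∃ u : ℂ, ‖u‖ = 1 ∧ ∀ z ∈ disk, ‖p - z‖ < 1 / B →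
      |k * (halfPlane p z).re + a * (halfPlane p z).im| ≤ K →
      ‖p - z‖ ≤ B * (1 - ‖z‖ ^ 2) ∧ |(u * (p - z)).re| ≤ K' * ‖p - z‖ ^ 2 := by
  obtain ⟨B, hB, h⟩ := exists_re_halfPlane_ge (k := k) (K := K) ha hp
  refine ⟨B, hB, (|K| + |k|) + 1, by positivity, (k + a * Complex.I) * conj p, ?_,
    fun z hz hzB hK => ?_⟩
  · rw [norm_mul, RCLike.norm_conj, hp, mul_one, ← sq_eq_sq₀ (norm_nonneg _) zero_le_one,
      norm_sq_eq]
    simpa using hka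
  · have hd : 0 < ‖p - z‖ := norm_pos_iff.2 (sub_ne_zero.2 (ne_of_mem_disk hp hz))
    constructor
    · have h1 := h z hz hK
      have hy := halfPlane_re_pos hp hz
      have hDy : 1 - ‖z‖ ^ 2 = (halfPlane p z).re * ‖p - z‖ ^ 2 := by
        rw [halfPlane_re hp]; field_simp
      rw [hDy]
      rw [div_le_iff₀ hd] at h1
      rw [lt_div_iff₀ hB] at hzB
      nlinarith
    · have h1 := halfPlane_strip_eq hp (ne_of_mem_disk hp hz) k a
      have h2 : |2 * ((k + a * Complex.I) * conj p * (p - z)).re| ≤ (|K| + |k|) * ‖p - z‖ ^ 2 := by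
        rw [h1, abs_mul, abs_of_nonneg (by positivity : 0 ≤ ‖p - z‖ ^ 2)]
        gcongr
        exact (abs_add_le _ _).trans (add_le_add_left (hK.trans (le_abs_self K)) _)
      rw [abs_mul, abs_two] at h2
      nlinarith [abs_nonneg ((k + a * Complex.I) * conj p * (p - z)).re, sq_nonneg ‖p - z‖]

open MeasureTheory in
/-- The part of the domain at Euclidean distance `O(1 / R)` of the circle has volume
`O(1 / R ^ 3)`. -/
theorem volume_ends_le {ι : Type*} [Fintype ι] {p : ι → ℂ} (hp : ∀ i, ‖p i‖ = 1) {Ω : Set ℂ}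
    (hΩ : Ω ⊆ disk)
    (hstrip : ∀ j, ∃ k a K : ℝ, k ^ 2 + a ^ 2 = 1 ∧ a ≠ 0 ∧ ∀ z ∈ Ω,
      |k * (halfPlane (p j) z).re + a * (halfPlane (p j) z).im| ≤ K)
    (hcl : ∀ q, ‖q‖ = 1 → (∀ i, q ≠ p i) → q ∉ closure Ω) :
    ∃ C R₀ : ℝ, 0 ≤ C ∧ 0 < R₀ ∧ ∀ R ≥ R₀,
      volume (Ω ∩ {z | 1 - ‖z‖ ^ 2 ≤ 2 / R}) ≤ ENNReal.ofReal (C / R ^ 3) := by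
  choose k a K hka ha hK using hstrip
  choose B hB K' hK' u hu hest using fun j => strip_estimate (K := K j) (hp j) (hka j) (ha j)
  set S : Set ℂ := closure Ω \ ⋃ j, ball (p j) (1 / B j) with hS
  have hclb : closure Ω ⊆ closedBall 0 1 :=
    closure_minimal (hΩ.trans ball_subset_closedBall) isClosed_closedBall
  have hScomp : IsCompact S :=
    ((isCompact_closedBall (0 : ℂ) 1).of_isClosed_subset isClosed_closure hclb).diff
      (isOpen_iUnion fun j => isOpen_ball)
  have hSdisk : ∀ z ∈ S, 0 < 1 - ‖z‖ ^ 2 := fun z hz => by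
    refine one_sub_norm_sq_pos (mem_disk_iff.2 ?_)
    have h1 : ‖z‖ ≤ 1 := by simpa using hclb hz.1
    refine h1.lt_of_ne fun h => hcl z h (fun i hi => hz.2 ?_) hz.1
    exact Set.mem_iUnion_of_mem i (by rw [hi]; exact mem_ball_self (by have := hB i; positivity))
  obtain ⟨m, hm, hmS⟩ : ∃ m > 0, ∀ z ∈ S, m ≤ 1 - ‖z‖ ^ 2 := by
    rcases S.eq_empty_or_nonempty with h | h
    · exact ⟨1, one_pos, by simp [h]⟩
    · obtain ⟨z, hz, hmin⟩ := hScomp.exists_isMinOn h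
        (f := fun z : ℂ => 1 - ‖z‖ ^ 2) (by fun_prop)
      exact ⟨_, hSdisk z hz, fun w hw => hmin hw⟩
  refine ⟨∑ j, 32 * K' j * B j ^ 3, 3 / m,
    Finset.sum_nonneg fun j _ => by have := hB j; have := hK' j; positivity, by positivity,
    fun R hR => ?_⟩
  have hR0 : 0 < R := lt_of_lt_of_le (by positivity) hR
  -- Away from the vertices the domain stays at a positive distance from the circle.
  have hsub : Ω ∩ {z | 1 - ‖z‖ ^ 2 ≤ 2 / R} ⊆ ⋃ j, {z : ℂ | ‖p j - z‖ ≤ 2 * B j / R ∧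
      |(u j * (p j - z)).re| ≤ K' j * (2 * B j / R) ^ 2} := by
    rintro z ⟨hz, hzR⟩
    have hzS : z ∉ S := fun h => by
      have h1 := hmS z h
      have h2 : m ≤ 2 / R := h1.trans hzR
      rw [le_div_iff₀ hR0] at h2
      rw [ge_iff_le, div_le_iff₀ hm] at hR
      linarith
    have hzU : z ∈ ⋃ j, ball (p j) (1 / B j) := by
      by_contra h
      exact hzS ⟨subset_closure hz, h⟩
    obtain ⟨j, hj⟩ := Set.mem_iUnion.1 hzU
    rw [mem_ball, dist_comm, dist_eq_norm] at hj
    obtain ⟨h1, h2⟩ := hest j z (hΩ hz) hj (hK j z hz)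
    have h3 : ‖p j - z‖ ≤ 2 * B j / R :=
      h1.trans ((mul_le_mul_of_nonneg_left hzR (hB j).le).trans_eq (by ring))
    have := hK' j
    exact Set.mem_iUnion_of_mem j ⟨h3, h2.trans (by gcongr)⟩
  refine (measure_mono hsub).trans ((measure_iUnion_fintype_le _ _).trans ?_)
  rw [Finset.sum_div, ENNReal.ofReal_sum_of_nonneg
    (fun j _ => by have := hB j; have := hK' j; positivity)]
  refine Finset.sum_le_sum fun j _ => ?_
  have := hB j
  have := hK' j
  refine (volume_rotated_rectangle_le (hu j) _ _ _).trans_eq ?_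
  rw [← ENNReal.ofReal_mul (by positivity)]
  congr 1
  field_simp
  ring

/-! ### The flux of a graph -/

/-- Strict monotonicity of `v ↦ v / √(1 + |v|²)`, for the norm scaled by `l`. Up to the factor
`(w₁ + w₂) / l²`, the pairing is `1` minus the scalar product of the unit normals of the two graphs. -/
lemma conormal_monotone {l g₁ e₁ g₂ e₂ : ℝ} (hl : 0 < l) {w₁ w₂ : ℝ}
    (h₁ : w₁ = Real.sqrt (1 + l ^ 2 * (g₁ ^ 2 + e₁ ^ 2)))
    (h₂ : w₂ = Real.sqrt (1 + l ^ 2 * (g₂ ^ 2 + e₂ ^ 2))) :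
    0 ≤ (g₁ - g₂) * (g₁ / w₁ - g₂ / w₂) + (e₁ - e₂) * (e₁ / w₁ - e₂ / w₂) ∧
    ((g₁ - g₂) * (g₁ / w₁ - g₂ / w₂) + (e₁ - e₂) * (e₁ / w₁ - e₂ / w₂) = 0 →
      g₁ = g₂ ∧ e₁ = e₂) := by
  have hw₁ : 0 < w₁ := h₁ ▸ Real.sqrt_pos.2 (by positivity)
  have hw₂ : 0 < w₂ := h₂ ▸ Real.sqrt_pos.2 (by positivity)
  have s₁ : w₁ ^ 2 = 1 + l ^ 2 * (g₁ ^ 2 + e₁ ^ 2) := by rw [h₁, Real.sq_sqrt (by positivity)]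
  have s₂ : w₂ ^ 2 = 1 + l ^ 2 * (g₂ ^ 2 + e₂ ^ 2) := by rw [h₂, Real.sq_sqrt (by positivity)]
  clear h₁ h₂
  set T := 1 + l ^ 2 * (g₁ * g₂ + e₁ * e₂) with hT
  have hid : (w₁ * w₂) ^ 2 - T ^ 2 =
      l ^ 2 * ((g₁ - g₂) ^ 2 + (e₁ - e₂) ^ 2) + l ^ 4 * (g₁ * e₂ - g₂ * e₁) ^ 2 := by
    rw [mul_pow, s₁, s₂, hT]; ring
  have hS : l ^ 2 * ((g₁ - g₂) * (g₁ / w₁ - g₂ / w₂) + (e₁ - e₂) * (e₁ / w₁ - e₂ / w₂)) =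
      (w₁ + w₂) * (w₁ * w₂ - T) / (w₁ * w₂) := by
    rw [hT]
    field_simp
    linear_combination -w₂ * s₁ - w₁ * s₂
  have hTle : T ≤ w₁ * w₂ := by
    refine (le_abs_self T).trans (abs_le_of_sq_le_sq ?_ (by positivity))
    have : 0 ≤ l ^ 2 * ((g₁ - g₂) ^ 2 + (e₁ - e₂) ^ 2) + l ^ 4 * (g₁ * e₂ - g₂ * e₁) ^ 2 := by
      positivity
    linarith
  constructor
  · have h0 : 0 ≤ (w₁ + w₂) * (w₁ * w₂ - T) / (w₁ * w₂) :=
      div_nonneg (mul_nonneg (by positivity) (by linarith)) (by positivity)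
    rw [← hS] at h0
    exact (mul_nonneg_iff_of_pos_left (by positivity)).1 h0
  · intro h0
    rw [h0, mul_zero, eq_comm, div_eq_zero_iff] at hS
    have hE : w₁ * w₂ - T = 0 := by
      rcases hS with h | h
      · exact (mul_eq_zero.1 h).resolve_left (by positivity)
      · exact absurd h (by positivity)
    have hE' : w₁ * w₂ = T := by linarith
    rw [hE', sub_self] at hid
    have hl2 : 0 < l ^ 2 := by positivity
    have h1 : l ^ 2 * ((g₁ - g₂) ^ 2 + (e₁ - e₂) ^ 2) = 0 := by
      have : 0 ≤ l ^ 2 * ((g₁ - g₂) ^ 2 + (e₁ - e₂) ^ 2) := by positivity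
      have : 0 ≤ l ^ 4 * (g₁ * e₂ - g₂ * e₁) ^ 2 := by positivity
      linarith
    have h2 := (mul_eq_zero.1 h1).resolve_left hl2.ne'
    constructor <;> nlinarith [sq_nonneg (g₁ - g₂), sq_nonneg (e₁ - e₂)]

/-- The `∂x` component of the Euclidean field `cf² Gu / √(1 + ‖Gu‖²)`, whose Euclidean divergence is `cf²`
times the hyperbolic divergence of `Gu / √(1 + ‖Gu‖²)`. -/
def fluxX (τ h : ℝ) (u : ℂ → ℝ) (z : ℂ) : ℝ := cf z ^ 2 * (gradX τ h u z / areaElt τ h u z)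

/-- The `∂y` component of the field of `fluxX`. -/
def fluxY (τ h : ℝ) (u : ℂ → ℝ) (z : ℂ) : ℝ := cf z ^ 2 * (gradY τ h u z / areaElt τ h u z)

lemma cf_pos {z : ℂ} (hz : z ∈ disk) : 0 < cf z := div_pos two_pos (one_sub_norm_sq_pos hz)

lemma contDiffOn_cf {W : Set ℂ} (hW : W ⊆ disk) : ContDiffOn ℝ 1 cf W := by
  unfold cf
  exact contDiffOn_const.div (contDiff_const.sub (contDiff_norm_sq ℝ)).contDiffOn
    fun z hz => (one_sub_norm_sq_pos (hW hz)).ne'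

lemma contDiffOn_coeff_sqrt {τ h : ℝ} (hh : |h| ≤ 1 / 2) {W : Set ℂ} (hW : W ⊆ disk) :
    ContDiffOn ℝ 1 (fun z : ℂ =>
      Real.sqrt ((1 + 4 * ‖z‖ ^ 2 * τ ^ 2) / (1 - 4 * h ^ 2 * ‖z‖ ^ 2))) W := by
  have hn : ContDiff ℝ 1 (fun z : ℂ => ‖z‖ ^ 2) := contDiff_norm_sq ℝ
  have hpos : ∀ z ∈ W, 0 < 1 - 4 * h ^ 2 * ‖z‖ ^ 2 := fun z hz => by
    have h1 := one_sub_norm_sq_pos (hW hz)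
    have h2 : h ^ 2 ≤ 1 / 4 := by rw [← sq_abs]; nlinarith [abs_nonneg h]
    nlinarith [sq_nonneg ‖z‖]
  refine ContDiffOn.sqrt (ContDiffOn.div ?_ ?_ fun z hz => (hpos z hz).ne') fun z hz => ?_
  · exact (contDiff_const.add ((contDiff_const.mul hn).mul contDiff_const)).contDiffOn
  · exact (contDiff_const.sub (contDiff_const.mul hn)).contDiffOn
  · exact (div_pos (by positivity) (hpos z hz)).ne'

lemma contDiff_re {m : WithTop ℕ∞} : ContDiff ℝ m Complex.re := Complex.reCLM.contDiff
lemma contDiff_im {m : WithTop ℕ∞} : ContDiff ℝ m Complex.im := Complex.imCLM.contDiff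

lemma contDiffOn_coeffA {τ h : ℝ} (hh : |h| ≤ 1 / 2) {W : Set ℂ} (hW : W ⊆ disk) :
    ContDiffOn ℝ 1 (coeffA τ h) W := by
  unfold coeffA
  exact ((contDiff_const.mul contDiff_im).mul contDiff_const).contDiffOn.add
    ((contDiff_const.mul contDiff_re).contDiffOn.mul (contDiffOn_coeff_sqrt hh hW))

lemma contDiffOn_coeffB {τ h : ℝ} (hh : |h| ≤ 1 / 2) {W : Set ℂ} (hW : W ⊆ disk) :
    ContDiffOn ℝ 1 (coeffB τ h) W := by
  unfold coeffB
  exact ((contDiff_const.mul contDiff_re).mul contDiff_const).contDiffOn.add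
    ((contDiff_const.mul contDiff_im).contDiffOn.mul (contDiffOn_coeff_sqrt hh hW))

lemma contDiffOn_fderiv_apply {u : ℂ → ℝ} {W : Set ℂ} (hW : IsOpen W) (hu : ContDiffOn ℝ 2 u W)
    (v : ℂ) : ContDiffOn ℝ 1 (fun z => fderiv ℝ u z v) W :=
  (hu.fderiv_of_isOpen hW (by norm_num)).clm_apply contDiffOn_const

lemma contDiffOn_gradX {τ h : ℝ} (hh : |h| ≤ 1 / 2) {u : ℂ → ℝ} {W : Set ℂ} (hWo : IsOpen W)
    (hW : W ⊆ disk) (hu : ContDiffOn ℝ 2 u W) : ContDiffOn ℝ 1 (gradX τ h u) W :=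
  ((contDiffOn_fderiv_apply hWo hu 1).add ((contDiffOn_cf hW).mul (contDiffOn_coeffA hh hW))).div
    ((contDiffOn_cf hW).pow 2) fun _ hz => pow_ne_zero 2 (cf_pos (hW hz)).ne'

lemma contDiffOn_gradY {τ h : ℝ} (hh : |h| ≤ 1 / 2) {u : ℂ → ℝ} {W : Set ℂ} (hWo : IsOpen W)
    (hW : W ⊆ disk) (hu : ContDiffOn ℝ 2 u W) : ContDiffOn ℝ 1 (gradY τ h u) W :=
  ((contDiffOn_fderiv_apply hWo hu Complex.I).add
    ((contDiffOn_cf hW).mul (contDiffOn_coeffB hh hW))).div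
    ((contDiffOn_cf hW).pow 2) fun _ hz => pow_ne_zero 2 (cf_pos (hW hz)).ne'

lemma areaElt_pos (τ h : ℝ) (u : ℂ → ℝ) (z : ℂ) : 0 < areaElt τ h u z :=
  Real.sqrt_pos.2 (by positivity)

lemma contDiffOn_areaElt {τ h : ℝ} (hh : |h| ≤ 1 / 2) {u : ℂ → ℝ} {W : Set ℂ} (hWo : IsOpen W)
    (hW : W ⊆ disk) (hu : ContDiffOn ℝ 2 u W) : ContDiffOn ℝ 1 (areaElt τ h u) W := by
  refine ContDiffOn.sqrt (contDiffOn_const.add (((contDiffOn_cf hW).pow 2).mul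
    (((contDiffOn_gradX hh hWo hW hu).pow 2).add ((contDiffOn_gradY hh hWo hW hu).pow 2)))) ?_
  intro z _
  positivity

lemma contDiffOn_fluxX {τ h : ℝ} (hh : |h| ≤ 1 / 2) {u : ℂ → ℝ} {W : Set ℂ} (hWo : IsOpen W)
    (hW : W ⊆ disk) (hu : ContDiffOn ℝ 2 u W) : ContDiffOn ℝ 1 (fluxX τ h u) W :=
  ((contDiffOn_cf hW).pow 2).mul ((contDiffOn_gradX hh hWo hW hu).div
    (contDiffOn_areaElt hh hWo hW hu) fun z _ => (areaElt_pos τ h u z).ne')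

lemma contDiffOn_fluxY {τ h : ℝ} (hh : |h| ≤ 1 / 2) {u : ℂ → ℝ} {W : Set ℂ} (hWo : IsOpen W)
    (hW : W ⊆ disk) (hu : ContDiffOn ℝ 2 u W) : ContDiffOn ℝ 1 (fluxY τ h u) W :=
  ((contDiffOn_cf hW).pow 2).mul ((contDiffOn_gradY hh hWo hW hu).div
    (contDiffOn_areaElt hh hWo hW hu) fun z _ => (areaElt_pos τ h u z).ne')

lemma IsHGraph.div_flux {τ h H : ℝ} {u : ℂ → ℝ} {W : Set ℂ} (hW : W ⊆ disk)
    (hu : IsHGraph τ h H W u) {z : ℂ} (hz : z ∈ W) :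
    dx (fluxX τ h u) z + dy (fluxY τ h u) z = 2 * H * cf z ^ 2 := by
  have h1 := hu.2 z hz
  have h2 := (cf_pos (hW hz)).ne'
  unfold meanCurvature hdiv at h1
  change (dx (fluxX τ h u) z + dy (fluxY τ h u) z) / cf z ^ 2 / 2 = H at h1
  field_simp at h1
  linarith

lemma abs_conormal_le {l g e w : ℝ} (hl : 0 < l) (hw : w = Real.sqrt (1 + l ^ 2 * (g ^ 2 + e ^ 2))) :
    |l ^ 2 * (g / w)| ≤ l ∧ |l ^ 2 * (e / w)| ≤ l := by
  have hw0 : 0 < w := hw ▸ Real.sqrt_pos.2 (by positivity)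
  have hg : l * |g| ≤ w := by
    rw [hw]
    apply Real.le_sqrt_of_sq_le
    rw [mul_pow, sq_abs]
    nlinarith [mul_nonneg (sq_nonneg l) (sq_nonneg e)]
  have he : l * |e| ≤ w := by
    rw [hw]
    apply Real.le_sqrt_of_sq_le
    rw [mul_pow, sq_abs]
    nlinarith [mul_nonneg (sq_nonneg l) (sq_nonneg g)]
  constructor
  · rw [abs_mul, abs_div, abs_of_pos hw0, abs_of_pos (by positivity : 0 < l ^ 2), ← mul_div_assoc,
      div_le_iff₀ hw0]
    nlinarith
  · rw [abs_mul, abs_div, abs_of_pos hw0, abs_of_pos (by positivity : 0 < l ^ 2), ← mul_div_assoc,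
      div_le_iff₀ hw0]
    nlinarith

lemma abs_fluxX_le (τ h : ℝ) (u : ℂ → ℝ) {z : ℂ} (hz : z ∈ disk) : |fluxX τ h u z| ≤ cf z :=
  (abs_conormal_le (cf_pos hz) rfl).1

lemma abs_fluxY_le (τ h : ℝ) (u : ℂ → ℝ) {z : ℂ} (hz : z ∈ disk) : |fluxY τ h u z| ≤ cf z :=
  (abs_conormal_le (cf_pos hz) rfl).2

/-- The difference of the fluxes of two graphs pairs nonnegatively with the difference of their
gradients, and to zero only if the gradients agree. -/
lemma flux_pairing (τ h : ℝ) (u₁ u₂ : ℂ → ℝ) {z : ℂ} (hz : z ∈ disk) :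
    0 ≤ (dx u₁ z - dx u₂ z) * (fluxX τ h u₁ z - fluxX τ h u₂ z) +
        (dy u₁ z - dy u₂ z) * (fluxY τ h u₁ z - fluxY τ h u₂ z) ∧
    ((dx u₁ z - dx u₂ z) * (fluxX τ h u₁ z - fluxX τ h u₂ z) +
        (dy u₁ z - dy u₂ z) * (fluxY τ h u₁ z - fluxY τ h u₂ z) = 0 →
      dx u₁ z = dx u₂ z ∧ dy u₁ z = dy u₂ z) := by
  have hl := cf_pos hz
  have hX : dx u₁ z - dx u₂ z = cf z ^ 2 * (gradX τ h u₁ z - gradX τ h u₂ z) := by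
    unfold gradX; field_simp; ring
  have hY : dy u₁ z - dy u₂ z = cf z ^ 2 * (gradY τ h u₁ z - gradY τ h u₂ z) := by
    unfold gradY; field_simp; ring
  obtain ⟨h1, h2⟩ := conormal_monotone (g₁ := gradX τ h u₁ z) (g₂ := gradX τ h u₂ z)
    (e₁ := gradY τ h u₁ z) (e₂ := gradY τ h u₂ z) hl (rfl : areaElt τ h u₁ z = _)
    (rfl : areaElt τ h u₂ z = _)
  have hid : (dx u₁ z - dx u₂ z) * (fluxX τ h u₁ z - fluxX τ h u₂ z) +
      (dy u₁ z - dy u₂ z) * (fluxY τ h u₁ z - fluxY τ h u₂ z) = cf z ^ 4 *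
      ((gradX τ h u₁ z - gradX τ h u₂ z) *
        (gradX τ h u₁ z / areaElt τ h u₁ z - gradX τ h u₂ z / areaElt τ h u₂ z) +
      (gradY τ h u₁ z - gradY τ h u₂ z) *
        (gradY τ h u₁ z / areaElt τ h u₁ z - gradY τ h u₂ z / areaElt τ h u₂ z)) := by
    rw [hX, hY]; unfold fluxX fluxY; ring
  rw [hid]
  refine ⟨by positivity, fun h0 => ?_⟩
  obtain ⟨e1, e2⟩ := h2 ((mul_eq_zero.1 h0).resolve_left (by positivity))
  rw [e1, sub_self, mul_zero] at hX
  rw [e2, sub_self, mul_zero] at hY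
  exact ⟨sub_eq_zero.1 hX, sub_eq_zero.1 hY⟩

open MeasureTheory in
lemma integral_fderiv_apply_eq_zero {F : ℂ → ℝ} (hF : ContDiff ℝ 1 F) (hc : HasCompactSupport F)
    (v : ℂ) : Integrable (fun z => fderiv ℝ F z v) ∧ ∫ z, fderiv ℝ F z v = 0 := by
  have hint : Integrable (fun z => fderiv ℝ F z v) :=
    ((hF.continuous_fderiv (by norm_num)).clm_apply continuous_const).integrable_of_hasCompactSupport
      (hc.fderiv_apply (𝕜 := ℝ) v)
  have hFi : Integrable F := hF.continuous.integrable_of_hasCompactSupport hc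
  refine ⟨hint, ?_⟩
  have := integral_mul_fderiv_eq_neg_fderiv_mul_of_integrable (μ := volume) (𝕜 := ℝ)
    (f := fun _ : ℂ => (1 : ℝ)) (g := F) (v := v) (by simp) (by simpa using hint)
    (by simpa using hFi) (fun x _ => differentiableAt_const _)
    (fun x _ => hF.differentiable (by norm_num) x)
  simpa using this

open MeasureTheory in
/-- A divergence-free field is orthogonal to the gradients of compactly supported functions. -/
lemma integral_grad_mul_eq_zero {W : Set ℂ} (hW : IsOpen W) {A B f : ℂ → ℝ}
    (hA : ContDiffOn ℝ 1 A W) (hB : ContDiffOn ℝ 1 B W)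
    (hdiv : ∀ z ∈ W, dx A z + dy B z = 0) (hf : ContDiff ℝ 1 f) (hc : HasCompactSupport f)
    (hfW : tsupport f ⊆ W) :
    Integrable (fun z => dx f z * A z + dy f z * B z) ∧
      ∫ z, (dx f z * A z + dy f z * B z) = 0 := by
  have key : ∀ {G : ℂ → ℝ}, ContDiffOn ℝ 1 G W →
      ContDiff ℝ 1 (fun z => f z * G z) ∧ HasCompactSupport (fun z => f z * G z) := by
    intro G hG
    refine ⟨contDiff_iff_contDiffAt.2 fun z => ?_, hc.mul_right⟩
    by_cases hz : z ∈ tsupport (fun z => f z * G z)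
    swap
    · exact contDiffAt_const.congr_of_eventuallyEq (notMem_tsupport_iff_eventuallyEq.1 hz)
    have hzW : z ∈ W := hfW (closure_mono (Function.support_mul_subset_left _ _) hz)
    exact hf.contDiffAt.mul (hG.contDiffAt (hW.mem_nhds hzW))
  obtain ⟨a1, a2⟩ := integral_fderiv_apply_eq_zero (key hA).1 (key hA).2 1
  obtain ⟨b1, b2⟩ := integral_fderiv_apply_eq_zero (key hB).1 (key hB).2 Complex.I
  have hEq : (fun z => dx f z * A z + dy f z * B z) =
      fun z => fderiv ℝ (fun z => f z * A z) z 1 + fderiv ℝ (fun z => f z * B z) z Complex.I := by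
    funext z
    by_cases hz : z ∈ tsupport f
    · have hzW := hW.mem_nhds (hfW hz)
      have h0 := hdiv z (hfW hz)
      unfold dx dy at *
      rw [fderiv_fun_mul (hf.differentiable (by norm_num) z)
          ((hA.contDiffAt hzW).differentiableAt (by norm_num)),
        fderiv_fun_mul (hf.differentiable (by norm_num) z)
          ((hB.contDiffAt hzW).differentiableAt (by norm_num))]
      simp only [add_apply, smul_apply, smul_eq_mul]
      linear_combination -f z * h0
    · have hf0 : f =ᶠ[𝓝 z] fun _ => 0 := notMem_tsupport_iff_eventuallyEq.1 hz
      have e1 : ∀ G : ℂ → ℝ, (fun z => f z * G z) =ᶠ[𝓝 z] fun _ => (0 : ℝ) := fun G =>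
        hf0.mono fun w hw => by simp [hw]
      unfold dx dy
      rw [hf0.fderiv_eq, (e1 A).fderiv_eq, (e1 B).fderiv_eq]
      simp
  rw [hEq]
  exact ⟨a1.add b1, by rw [integral_add a1 b1, a2, b2, add_zero]⟩

/-! ### The test function argument -/

lemma deriv_smoothTransition_eq_zero {t : ℝ} (ht : t < 0 ∨ 1 < t) :
    deriv Real.smoothTransition t = 0 := by
  rcases ht with ht | ht
  · have : Real.smoothTransition =ᶠ[𝓝 t] fun _ => 0 :=
      (eventually_lt_nhds ht).mono fun s hs => Real.smoothTransition.zero_of_nonpos hs.le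
    rw [this.deriv_eq, deriv_const]
  · have : Real.smoothTransition =ᶠ[𝓝 t] fun _ => 1 :=
      (eventually_gt_nhds ht).mono fun s hs => Real.smoothTransition.one_of_one_le hs.le
    rw [this.deriv_eq, deriv_const]

lemma exists_deriv_smoothTransition_le :
    ∃ M > 0, ∀ t, |deriv Real.smoothTransition t| ≤ M := by
  have hcont : Continuous (deriv Real.smoothTransition) :=
    (Real.smoothTransition.contDiff (n := 1)).continuous_deriv le_rfl
  obtain ⟨M, hM⟩ := isCompact_Icc.exists_bound_of_continuousOn (s := Set.Icc (0 : ℝ) 1)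
    hcont.continuousOn
  refine ⟨|M| + 1, by positivity, fun t => ?_⟩
  by_cases ht : t ∈ Set.Icc (0 : ℝ) 1
  · have := hM t ht
    rw [Real.norm_eq_abs] at this
    linarith [le_abs_self M]
  · rw [deriv_smoothTransition_eq_zero, abs_zero]
    · positivity
    · by_contra! h
      exact ht ⟨h.1, h.2⟩

lemma differentiable_smoothTransition : Differentiable ℝ Real.smoothTransition :=
  (Real.smoothTransition.contDiff (n := 1)).differentiable (by norm_num)

/-- A cutoff function equal to `1` where `1 - |z|² ≥ 2 / R` and to `0` where `1 - |z|² ≤ 1 / R`. -/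
def cutoff (R : ℝ) (z : ℂ) : ℝ := Real.smoothTransition (R * (1 - ‖z‖ ^ 2) - 1)

lemma contDiff_cutoff (R : ℝ) : ContDiff ℝ 1 (cutoff R) :=
  Real.smoothTransition.contDiff.comp
    ((contDiff_const.mul (contDiff_const.sub (contDiff_norm_sq ℝ))).sub contDiff_const)

lemma fderiv_cutoff (R : ℝ) (z v : ℂ) : fderiv ℝ (cutoff R) z v =
    deriv Real.smoothTransition (R * (1 - ‖z‖ ^ 2) - 1) * (-(R * (2 * inner ℝ z v))) := by
  have h1 : HasFDerivAt (fun z : ℂ => R * (1 - ‖z‖ ^ 2) - 1)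
      (R • (-((2 : ℕ) • (innerSL ℝ z : ℂ →L[ℝ] ℝ)))) z :=
    (((hasStrictFDerivAt_norm_sq z).hasFDerivAt.const_sub 1).const_mul R).sub_const 1
  have h2 := (differentiable_smoothTransition (R * (1 - ‖z‖ ^ 2) - 1)).hasDerivAt.comp_hasFDerivAt
    z h1
  have h3 : cutoff R = Real.smoothTransition ∘ fun z : ℂ => R * (1 - ‖z‖ ^ 2) - 1 := rfl
  rw [h3, h2.fderiv]
  simp only [smul_apply, neg_apply, coe_innerSL_apply, smul_eq_mul, nsmul_eq_mul, Nat.cast_ofNat]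
  ring

lemma abs_fderiv_cutoff_le {M : ℝ} (hM : ∀ t, |deriv Real.smoothTransition t| ≤ M) {R : ℝ}
    (hR : 0 < R) {z v : ℂ} (hz : z ∈ disk) (hv : ‖v‖ = 1) :
    |fderiv ℝ (cutoff R) z v| ≤ 2 * M * R := by
  have h1 : |inner ℝ z v| ≤ 1 := by
    have := abs_real_inner_le_norm z v
    rw [hv, mul_one] at this
    exact this.trans (mem_disk_iff.1 hz).le
  have hM0 : 0 ≤ M := (abs_nonneg _).trans (hM 0)
  rw [fderiv_cutoff, abs_mul, abs_neg, abs_mul, abs_mul, abs_two, abs_of_pos hR]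
  calc _ ≤ M * (R * (2 * 1)) := by gcongr; exact hM _
    _ = 2 * M * R := by ring

lemma fderiv_cutoff_eq_zero {R : ℝ} (hR : 0 < R) {z : ℂ} (v : ℂ)
    (hz : 1 - ‖z‖ ^ 2 < 1 / R ∨ 2 / R < 1 - ‖z‖ ^ 2) : fderiv ℝ (cutoff R) z v = 0 := by
  rw [fderiv_cutoff, deriv_smoothTransition_eq_zero, zero_mul]
  rw [lt_div_iff₀ hR, div_lt_iff₀ hR] at hz
  exact hz.imp (fun h => by linarith) fun h => by linarith

open MeasureTheory in
/-- If the ends of the domain are thin, a divergence-free field with components at most `2 cf` that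
pairs nonnegatively with the gradient of `d` is orthogonal to the gradient of `σ(d)`, where `σ` is the
smooth step function. -/
lemma deriv_mul_pairing_eq_zero {W Ω : Set ℂ} (hWo : IsOpen W) (hWΩ : W ⊆ Ω) (hΩo : IsOpen Ω)
    (hΩ : Ω ⊆ disk) {C R₀ : ℝ} (hC : 0 ≤ C) (hR₀ : 0 < R₀)
    (hvol : ∀ R ≥ R₀, volume (Ω ∩ {z | 1 - ‖z‖ ^ 2 ≤ 2 / R}) ≤ ENNReal.ofReal (C / R ^ 3))
    {d A B : ℂ → ℝ} (hd : ContDiffOn ℝ 1 d W) (hA : ContDiffOn ℝ 1 A W)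
    (hB : ContDiffOn ℝ 1 B W) (hdiv : ∀ z ∈ W, dx A z + dy B z = 0)
    (hAb : ∀ z ∈ W, |A z| ≤ 2 * cf z) (hBb : ∀ z ∈ W, |B z| ≤ 2 * cf z)
    (hcomp : ∀ r > 0, IsCompact {z | z ∈ W ∧ 0 ≤ d z ∧ r ≤ 1 - ‖z‖ ^ 2})
    (hQ : ∀ z ∈ W, 0 ≤ dx d z * A z + dy d z * B z) :
    ∀ z ∈ W, deriv Real.smoothTransition (d z) * (dx d z * A z + dy d z * B z) = 0 := by
  set g : ℂ → ℝ := fun z => deriv Real.smoothTransition (d z) * (dx d z * A z + dy d z * B z)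
    with hg
  have hσ' : Continuous (deriv Real.smoothTransition) :=
    (Real.smoothTransition.contDiff (n := 1)).continuous_deriv le_rfl
  have hfd : ∀ v : ℂ, ContinuousOn (fun z => fderiv ℝ d z v) W := fun v =>
    (hd.continuousOn_fderiv_of_isOpen hWo le_rfl).clm_apply continuousOn_const
  have hgc : ContinuousOn g W :=
    (hσ'.comp_continuousOn hd.continuousOn).mul
      (((hfd 1).mul hA.continuousOn).add ((hfd Complex.I).mul hB.continuousOn))
  have hg0 : ∀ z ∈ W, 0 ≤ g z := fun z hz =>
    mul_nonneg Real.smoothTransition.monotone.deriv_nonneg (hQ z hz)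
  intro z₀ hz₀
  by_contra hne
  have hgz₀ : 0 < g z₀ := (hg0 z₀ hz₀).lt_of_ne' hne
  have hD₀ := one_sub_norm_sq_pos (hΩ (hWΩ hz₀))
  set m := (1 - ‖z₀‖ ^ 2) / 2 with hm
  have hm0 : 0 < m := by positivity
  set c := g z₀ / 2 with hc
  have hc0 : 0 < c := by positivity
  set U : Set ℂ := (W ∩ g ⁻¹' Set.Ioi c) ∩ {z | m < 1 - ‖z‖ ^ 2} with hU
  have hUo : IsOpen U := (hgc.isOpen_inter_preimage hWo isOpen_Ioi).inter
    (isOpen_lt continuous_const (by fun_prop))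
  have hz₀U : z₀ ∈ U := ⟨⟨hz₀, by simp only [Set.mem_preimage, Set.mem_Ioi]; linarith⟩, by
    simp only [Set.mem_ofPred_eq]; linarith⟩
  have hUfin : volume U < ⊤ :=
    (measure_mono fun z hz => hΩ (hWΩ hz.1.1)).trans_lt measure_ball_lt_top
  have hUpos : 0 < volume.real U :=
    ENNReal.toReal_pos (hUo.measure_pos volume ⟨z₀, hz₀U⟩).ne' hUfin.ne
  obtain ⟨M, hM0, hM⟩ := exists_deriv_smoothTransition_le
  -- The integral of the pairing against the cutoff is bounded below by `c * volume U` for large `R`,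
  -- while the part of the integral that contains the gradient of the cutoff is `O(1 / R)`.
  suffices key : ∀ R ≥ max R₀ (2 / m), c * volume.real U ≤ 16 * M * C / R by
    set R := max R₀ (2 / m) + 16 * M * C / (c * volume.real U) + 1 with hR
    have hmax : 0 < max R₀ (2 / m) := lt_max_of_lt_left hR₀
    have hRle : max R₀ (2 / m) ≤ R := by
      have : 0 ≤ 16 * M * C / (c * volume.real U) := by positivity
      linarith
    have hR0 : 0 < R := hmax.trans_le hRle
    have h1 := key R hRle
    have h2 : 16 * M * C / (c * volume.real U) < R := by linarith
    rw [le_div_iff₀ hR0] at h1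
    rw [div_lt_iff₀ (by positivity)] at h2
    linarith
  intro R hR
  have hR0 : 0 < R := hR₀.trans_le ((le_max_left _ _).trans hR)
  have hRm : 2 / R ≤ m := by
    have := (le_max_right _ _).trans hR
    rw [div_le_iff₀ hm0] at this
    rw [div_le_iff₀ hR0]
    linarith
  set f : ℂ → ℝ := W.indicator fun z => cutoff R z * Real.smoothTransition (d z) with hf
  have hfts : tsupport f ⊆ {z | z ∈ W ∧ 0 ≤ d z ∧ 1 / R ≤ 1 - ‖z‖ ^ 2} := by
    refine closure_minimal (fun z hz => ?_) (hcomp _ (by positivity)).isClosed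
    have hzW : z ∈ W := Set.mem_of_indicator_ne_zero hz
    rw [Function.mem_support, hf, Set.indicator_of_mem hzW, mul_ne_zero_iff] at hz
    refine ⟨hzW, ?_, ?_⟩
    · by_contra! h
      exact hz.2 (Real.smoothTransition.zero_of_nonpos h.le)
    · by_contra! h
      rw [lt_div_iff₀ hR0] at h
      exact hz.1 (Real.smoothTransition.zero_of_nonpos (by linarith))
  have hfW : tsupport f ⊆ W := fun z hz => (hfts hz).1
  have hfeq : ∀ z ∈ W, f =ᶠ[𝓝 z] fun z => cutoff R z * Real.smoothTransition (d z) :=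
    fun z hz => (hWo.mem_nhds hz |> Filter.eventually_of_mem) fun w hw =>
      Set.indicator_of_mem hw _
  have hfC : ContDiff ℝ 1 f := by
    refine contDiff_iff_contDiffAt.2 fun z => ?_
    by_cases hz : z ∈ tsupport f
    · have hzW := hfW hz
      exact ((contDiff_cutoff R).contDiffAt.mul (Real.smoothTransition.contDiffAt.comp z
        (hd.contDiffAt (hWo.mem_nhds hzW)))).congr_of_eventuallyEq (hfeq z hzW)
    · exact contDiffAt_const.congr_of_eventuallyEq (notMem_tsupport_iff_eventuallyEq.1 hz)
  have hfc : HasCompactSupport f :=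
    (hcomp _ (by positivity)).of_isClosed_subset (isClosed_tsupport f) hfts
  obtain ⟨hGi, hG0⟩ := integral_grad_mul_eq_zero hWo hA hB hdiv hfC hfc hfW
  set E : Set ℂ := Ω ∩ {z | 1 - ‖z‖ ^ 2 ≤ 2 / R} with hE
  have hEm : MeasurableSet E := hΩo.measurableSet.inter
    (isClosed_le (by fun_prop) continuous_const).measurableSet
  have hEv := hvol R ((le_max_left _ _).trans hR)
  have hEfin : volume E < ⊤ := hEv.trans_lt ENNReal.ofReal_lt_top
  have hEr : volume.real E ≤ C / R ^ 3 := ENNReal.toReal_le_of_le_ofReal (by positivity) hEv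
  set b := 16 * M * R ^ 2 with hb
  have hb0 : 0 ≤ b := by positivity
  have hpt : ∀ z, U.indicator (fun _ => c) z ≤
      (dx f z * A z + dy f z * B z) + E.indicator (fun _ => b) z := by
    intro z
    have hE0 : 0 ≤ E.indicator (fun _ => b) z := Set.indicator_nonneg (fun _ _ => hb0) z
    by_cases hzW : z ∈ W
    · have hzd := hΩ (hWΩ hzW)
      have hdd : DifferentiableAt ℝ d z :=
        (hd.contDiffAt (hWo.mem_nhds hzW)).differentiableAt (by norm_num)
      have hcomp' := (differentiable_smoothTransition (d z)).hasDerivAt.comp_hasFDerivAt z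
        hdd.hasFDerivAt
      have hfder : ∀ v, fderiv ℝ f z v = cutoff R z * (deriv Real.smoothTransition (d z) *
          fderiv ℝ d z v) + Real.smoothTransition (d z) * fderiv ℝ (cutoff R) z v := fun v => by
        have hmul : HasFDerivAt (fun z => cutoff R z * Real.smoothTransition (d z)) _ z :=
          ((contDiff_cutoff R).differentiable (by norm_num) z).hasFDerivAt.mul hcomp'
        rw [(hfeq z hzW).fderiv_eq, hmul.fderiv]
        simp
      have hsplit : dx f z * A z + dy f z * B z = cutoff R z * g z + Real.smoothTransition (d z) *
          (fderiv ℝ (cutoff R) z 1 * A z + fderiv ℝ (cutoff R) z Complex.I * B z) := by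
        simp only [dx, dy, hg]
        rw [hfder, hfder]; ring
      have hN : -E.indicator (fun _ => b) z ≤ Real.smoothTransition (d z) *
          (fderiv ℝ (cutoff R) z 1 * A z + fderiv ℝ (cutoff R) z Complex.I * B z) := by
        by_cases hzR : 1 - ‖z‖ ^ 2 < 1 / R ∨ 2 / R < 1 - ‖z‖ ^ 2
        · rw [fderiv_cutoff_eq_zero hR0 _ hzR, fderiv_cutoff_eq_zero hR0 _ hzR]
          simpa using hE0
        · push Not at hzR
          rw [Set.indicator_of_mem (show z ∈ E from ⟨hWΩ hzW, hzR.2⟩)]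
          have hcf : cf z ≤ 2 * R := by
            unfold cf
            rw [div_le_iff₀ (one_sub_norm_sq_pos hzd)]
            have := hzR.1
            rw [div_le_iff₀ hR0] at this
            linarith
          have e1 := abs_fderiv_cutoff_le hM hR0 hzd (v := 1) (by simp)
          have e2 := abs_fderiv_cutoff_le hM hR0 hzd (v := Complex.I) (by simp)
          have e3 : |A z| ≤ 4 * R := (hAb z hzW).trans (by linarith)
          have e4 : |B z| ≤ 4 * R := (hBb z hzW).trans (by linarith)
          have e5 : |fderiv ℝ (cutoff R) z 1 * A z + fderiv ℝ (cutoff R) z Complex.I * B z| ≤ b :=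
            calc _ ≤ |fderiv ℝ (cutoff R) z 1| * |A z|
                    + |fderiv ℝ (cutoff R) z Complex.I| * |B z| := by
                  rw [← abs_mul, ← abs_mul]; exact abs_add_le _ _
              _ ≤ 2 * M * R * (4 * R) + 2 * M * R * (4 * R) := by gcongr
              _ = b := by rw [hb]; ring
          have e6 : |Real.smoothTransition (d z) * (fderiv ℝ (cutoff R) z 1 * A z
              + fderiv ℝ (cutoff R) z Complex.I * B z)| ≤ 1 * b := by
            rw [abs_mul, abs_of_nonneg (Real.smoothTransition.nonneg _)]
            gcongr
            exact Real.smoothTransition.le_one _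
          rw [one_mul] at e6
          exact (abs_le.1 e6).1
      have hP : U.indicator (fun _ => c) z ≤ cutoff R z * g z := by
        by_cases hzU : z ∈ U
        · rw [Set.indicator_of_mem hzU]
          have hone : cutoff R z = 1 := by
            apply Real.smoothTransition.one_of_one_le
            have : 2 / R ≤ 1 - ‖z‖ ^ 2 := hRm.trans (le_of_lt hzU.2)
            rw [div_le_iff₀ hR0] at this
            linarith
          rw [hone, one_mul]
          exact le_of_lt hzU.1.2
        · rw [Set.indicator_of_notMem hzU]
          exact mul_nonneg (Real.smoothTransition.nonneg _) (hg0 z hzW)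
      rw [hsplit]
      linarith
    · have hf0 : f =ᶠ[𝓝 z] fun _ => 0 :=
        notMem_tsupport_iff_eventuallyEq.1 fun h => hzW (hfW h)
      rw [Set.indicator_of_notMem fun h : z ∈ U => hzW h.1.1]
      simpa [dx, dy, hf0.fderiv_eq] using hE0
  have hUi : Integrable (U.indicator fun _ => c) :=
    (integrable_indicator_iff hUo.measurableSet).2 (integrableOn_const hUfin.ne)
  have hEi : Integrable (E.indicator fun _ => b) :=
    (integrable_indicator_iff hEm).2 (integrableOn_const hEfin.ne)
  have hint := integral_mono hUi (hGi.add hEi) hpt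
  simp only [Pi.add_apply] at hint
  rw [integral_add hGi hEi, hG0, zero_add, integral_indicator_const _ hUo.measurableSet,
    integral_indicator_const _ hEm, smul_eq_mul, smul_eq_mul] at hint
  calc c * volume.real U ≤ b * volume.real E := by linarith
    _ ≤ b * (C / R ^ 3) := by gcongr
    _ = 16 * M * C / R := by rw [hb]; field_simp

end KillingGraph

end

open KillingGraph

theorem theorem7p7 (τ h H : ℝ) (hh : |h| ≤ 1 / 2) (hH : |H| < 1 / 2)
    {n : ℕ} [NeZero n] (p : Fin n → ℂ) (Γ : Fin n → Set ℂ)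
    (hpoly : KillingGraph.IsIdealHPolygon H p Γ)
    (hclose : ∀ i : Fin n, KillingGraph.ArbitrarilyCloseAt (p (i + 1)) (Γ i) (Γ (i + 1)))
    (Ω₀ : Set ℂ) (hΩ₀ : KillingGraph.IsDomainOfDisk Ω₀)
    (hbd : KillingGraph.hbdry Ω₀ = ⋃ i, Γ i)
    (W : Set ℂ) (hW : KillingGraph.IsDomainOfDisk W) (hWΩ₀ : W ⊆ Ω₀)
    (u₁ u₂ : ℂ → ℝ)
    (hu₁ : KillingGraph.IsHGraph τ h H W u₁) (hu₂ : KillingGraph.IsHGraph τ h H W u₂)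
    (hc₁ : ContinuousOn u₁ (KillingGraph.hclosure W))
    (hc₂ : ContinuousOn u₂ (KillingGraph.hclosure W))
    (hlt : ∀ z ∈ KillingGraph.hbdry W, u₁ z < u₂ z) :
    ∀ z ∈ W, u₁ z ≤ u₂ z := by
  obtain ⟨hWo, hWc, hWd⟩ := hW
  obtain ⟨hstrip, hcl⟩ := hpoly.ends hH hclose hΩ₀ hbd
  obtain ⟨C, R₀, hC, hR₀, hvol⟩ := volume_ends_le hpoly.vertex_ideal hΩ₀.2.2 hstrip hcl
  have hdc : ContinuousOn (fun z => u₁ z - u₂ z) (hclosure W) := hc₁.sub hc₂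
  have hneg_bdry : ∀ z ∈ hclosure W, z ∉ W → u₁ z - u₂ z < 0 := fun z hz hzW => by
    have : z ∈ hbdry W := ⟨⟨hz.1, by rwa [hWo.interior_eq]⟩, hz.2⟩
    linarith [hlt z this]
  have hcomp : ∀ r > 0, IsCompact {z | z ∈ W ∧ 0 ≤ u₁ z - u₂ z ∧ r ≤ 1 - ‖z‖ ^ 2} := by
    intro r hr
    refine (isCompact_closedBall (0 : ℂ) 1).of_isClosed_subset ?_
      fun z hz => ball_subset_closedBall (hWd hz.1)
    have hclosed : IsClosed (closure W ∩ {z : ℂ | r ≤ 1 - ‖z‖ ^ 2}) :=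
      isClosed_closure.inter (isClosed_le continuous_const (by fun_prop))
    have hsub : closure W ∩ {z : ℂ | r ≤ 1 - ‖z‖ ^ 2} ⊆ hclosure W := fun z hz => by
      refine ⟨hz.1, mem_disk_iff.2 ?_⟩
      have : r ≤ 1 - ‖z‖ ^ 2 := hz.2
      nlinarith [norm_nonneg z]
    convert (hdc.mono hsub).preimage_isClosed_of_isClosed hclosed (isClosed_Ici (a := 0)) using 1
    ext z
    constructor
    · rintro ⟨h1, h2, h3⟩
      exact ⟨⟨subset_closure h1, h3⟩, h2⟩
    · rintro ⟨h1, h2⟩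
      refine ⟨?_, h2, h1.2⟩
      by_contra hzW
      exact absurd (hneg_bdry z (hsub h1) hzW) (not_lt.2 h2)
  have hdW : ∀ z ∈ W, DifferentiableAt ℝ u₁ z ∧ DifferentiableAt ℝ u₂ z := fun z hz =>
    ⟨(hu₁.1.contDiffAt (hWo.mem_nhds hz)).differentiableAt (by norm_num),
      (hu₂.1.contDiffAt (hWo.mem_nhds hz)).differentiableAt (by norm_num)⟩
  have hdx : ∀ z ∈ W, dx (fun z => u₁ z - u₂ z) z = dx u₁ z - dx u₂ z := fun z hz => by
    unfold dx; rw [fderiv_fun_sub (hdW z hz).1 (hdW z hz).2]; rfl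
  have hdy : ∀ z ∈ W, dy (fun z => u₁ z - u₂ z) z = dy u₁ z - dy u₂ z := fun z hz => by
    unfold dy; rw [fderiv_fun_sub (hdW z hz).1 (hdW z hz).2]; rfl
  have hX₁ := contDiffOn_fluxX (τ := τ) hh hWo hWd hu₁.1
  have hX₂ := contDiffOn_fluxX (τ := τ) hh hWo hWd hu₂.1
  have hY₁ := contDiffOn_fluxY (τ := τ) hh hWo hWd hu₁.1
  have hY₂ := contDiffOn_fluxY (τ := τ) hh hWo hWd hu₂.1
  have hda : ∀ {G : ℂ → ℝ}, ContDiffOn ℝ 1 G W → ∀ z ∈ W, DifferentiableAt ℝ G z :=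
    fun hG z hz => (hG.contDiffAt (hWo.mem_nhds hz)).differentiableAt (by norm_num)
  have hdiv : ∀ z ∈ W, dx (fun z => fluxX τ h u₁ z - fluxX τ h u₂ z) z
      + dy (fun z => fluxY τ h u₁ z - fluxY τ h u₂ z) z = 0 := fun z hz => by
    have e1 := hu₁.div_flux hWd hz
    have e2 := hu₂.div_flux hWd hz
    unfold dx dy at *
    rw [fderiv_fun_sub (hda hX₁ z hz) (hda hX₂ z hz), fderiv_fun_sub (hda hY₁ z hz) (hda hY₂ z hz)]
    simp only [sub_apply]
    linarith
  have hzero := deriv_mul_pairing_eq_zero hWo hWΩ₀ hΩ₀.1 hΩ₀.2.2 hC hR₀ hvol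
    (d := fun z => u₁ z - u₂ z) ((hu₁.1.sub hu₂.1).of_le (by norm_num)) (hX₁.sub hX₂)
    (hY₁.sub hY₂) hdiv
    (fun z hz => (abs_sub _ _).trans (by
      linarith [abs_fluxX_le τ h u₁ (hWd hz), abs_fluxX_le τ h u₂ (hWd hz)]))
    (fun z hz => (abs_sub _ _).trans (by
      linarith [abs_fluxY_le τ h u₁ (hWd hz), abs_fluxY_le τ h u₂ (hWd hz)]))
    hcomp (fun z hz => by
      rw [hdx z hz, hdy z hz]; exact (flux_pairing τ h u₁ u₂ (hWd hz)).1)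
  have hconst : ∀ z ∈ W, ∀ w ∈ W, Real.smoothTransition (u₁ z - u₂ z) =
      Real.smoothTransition (u₁ w - u₂ w) := by
    have hder : ∀ z ∈ W, HasFDerivAt (fun z => Real.smoothTransition (u₁ z - u₂ z))
        (deriv Real.smoothTransition (u₁ z - u₂ z) • (fderiv ℝ u₁ z - fderiv ℝ u₂ z)) z :=
      fun z hz => (differentiable_smoothTransition _).hasDerivAt.comp_hasFDerivAt z
        ((hdW z hz).1.hasFDerivAt.sub (hdW z hz).2.hasFDerivAt)
    intro z hz w hw
    refine hWo.is_const_of_fderiv_eq_zero (𝕜 := ℝ) hWc.isPreconnected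
      (f := fun z => Real.smoothTransition (u₁ z - u₂ z))
      (fun z hz => (hder z hz).differentiableAt.differentiableWithinAt) (fun z hz => ?_) hz hw
    rw [(hder z hz).fderiv, Pi.zero_apply]
    have h0 := hzero z hz
    rw [hdx z hz, hdy z hz] at h0
    rcases mul_eq_zero.1 h0 with h0 | h0
    · rw [h0, zero_smul]
    · obtain ⟨e1, e2⟩ := (flux_pairing τ h u₁ u₂ (hWd hz)).2 h0
      have : fderiv ℝ u₁ z = fderiv ℝ u₂ z := by
        ext v
        have hv : v = v.re • (1 : ℂ) + v.im • Complex.I := by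
          apply Complex.ext <;> simp
        unfold dx at e1
        unfold dy at e2
        rw [hv, map_add, map_add, map_smul, map_smul, map_smul, map_smul, e1, e2]
      rw [this, sub_self, smul_zero]
  -- If `d` is positive at one point, it is positive on `W`, and `W` is closed in the disk.
  intro z₀ hz₀
  by_contra! hgt
  have hpos : ∀ z ∈ W, 0 < u₁ z - u₂ z := fun z hz => by
    by_contra! hle
    have h1 := Real.smoothTransition.pos_of_pos (sub_pos.2 hgt)
    rw [hconst z₀ hz₀ z hz, Real.smoothTransition.zero_of_nonpos hle] at h1
    exact lt_irrefl _ h1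
  have hWall : disk ⊆ W := by
    refine (convex_ball (0 : ℂ) 1).isPreconnected.subset_of_closure_inter_subset hWo
      ⟨z₀, hWd hz₀, hz₀⟩ fun z hz => ?_
    by_contra hzW
    have hneg := hneg_bdry z hz hzW
    have hnn : 0 ≤ u₁ z - u₂ z := by
      have hmem : z ∈ closure W := hz.1
      have hcw : ContinuousWithinAt (fun z => u₁ z - u₂ z) W z :=
        (hdc z hz).mono fun w hw => ⟨subset_closure hw, hWd hw⟩
      exact closure_minimal (s := (fun z => u₁ z - u₂ z) '' W) (t := Set.Ici 0)
        (by rintro _ ⟨w, hw, rfl⟩; exact (hpos w hw).le) isClosed_Ici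
        (hcw.mem_closure_image hmem)
    linarith
  have hΓ : (Γ 0).Nonempty := by
    obtain ⟨-, γ, -, -, -, -, h⟩ := hpoly.edge 0
    rw [← h]; exact Set.range_nonempty _
  obtain ⟨z, hz⟩ := hΓ
  have hzb : z ∈ hbdry Ω₀ := by rw [hbd]; exact Set.mem_iUnion_of_mem 0 hz
  have := hzb.1.2
  rw [hΩ₀.1.interior_eq] at this
  exact this (hWΩ₀ (hWall hzb.2))
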